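/- Let $n\ge 1$ and let $K\subset\mathbb R^n$ be a compact, strictly convex set with non-empty interior and $K=-K$. Let $g_K(x)=\|x\|_K=\inf\{r>0 : x\in rK\}$ be its gauge, and let $T=K^\circ=\{p\in\mathbb R^n : \langle q,p\rangle\le 1 \text{ for all } q\in K\}$ be its polar body. Write $\partial g(x)$ for the subdifferential of a convex function $g$ at $x$, so $\partial g(x)=\{\nabla g(x)\}$ wherever $g$ is differentiable (in particular $\partial g_K(q)=\{\nabla g_K(q)\}$ for $q\in\partial K$ if $K$ has smooth boundary). Fix $1\le r\le\infty$. A closed $(K,T)$-billiard trajectory is a continuous, piecewise $C^r$ map $\gamma=(q,p):S^1=\mathbb R/\mathbb Z\to\partial(K\times T)$ for which there is a constant $d>0$ such that, for every $t$ with $\gamma(t)\notin\partial K\times\partial T$, $\gamma$ is differentiable at $t$ and $$\dot\gamma(t)=d\,(-v,0)\ \text{ for some } v\in\partial g_T(p(t)),\ \text{ if } q(t)\in\operatorname{int}K,\ p(t)\in\partial T,$$ $$\dot\gamma(t)=d\,(0,w)\ \text{ for some } w\in\partial g_K(q(t)),\ \text{ if } q(t)\in\partial K,\ p(t)\in\operatorname{int}T,$$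 while for every $t$ with $\gamma(t)\in\partial K\times\partial T$ the left and right derivatives of $\gamma$ at $t$ exist and each is of the form $\alpha(-v,0)+\beta(0,w)$ with $v\in\partial g_T(p(t))$, $w\in\partial g_K(q(t))$, $\alpha,\beta\ge0$, $(\alpha,\beta)\ne(0,0)$. The closed curve $c=q(\cdot)$ in $K$ is then called a periodic $K^\circ$-billiard trajectory in $K$. Its $\|\cdot\|_K$-length is $\int_0^1\|\dot c(t)\|_K\,dt$. For $q\in\partial K$, a closed curve $c$ is the two-bounce orbit $[-q,q]$ if in one period it runs once from $q$ to $-q$ and back along the segment $[-q,q]$, at constant speed on each of the two passages, possibly resting for a time interval at each of the points $q$ and $-q$. Then: 1. A periodic $K^\circ$-billiard trajectory in $K$ has the smallest $\|\cdot\|_K$-length among all periodic $K^\circ$-billiard trajectories in $K$ if and only if it is a two-bounce orbit $[-q,q]$ for some $q\in\partial K$. 2. For every $q\in\partial K$ there is a periodic $K^\circ$-billiard trajectory in $K$ which is the two-bounce orbit $[-q,q]$. 3. The minimum of the $\|\cdot\|_K$-lengths of the periodic $K^\circ$-billiard trajectories in $K$ exists and equals $4$. -/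

import Mathlib

noncomputable section

namespace MinkowskiBilliard

/-- The polar body `K° = {p | ⟨q, p⟩ ≤ 1 for all q ∈ K}`, with the dual of `ℝⁿ` identified with
`ℝⁿ` through the standard inner product. -/
def polarBody {n : ℕ} (K : Set (EuclideanSpace ℝ (Fin n))) : Set (EuclideanSpace ℝ (Fin n)) :=
  {p | ∀ q ∈ K, inner ℝ q p ≤ 1}

/-- The subdifferential of a real function at a point.  For a convex function which is
differentiable at the point it consists of the gradient alone, see
`subdifferential_eq_singleton`. -/
def subdifferential {n : ℕ} (f : EuclideanSpace ℝ (Fin n) → ℝ) (x : EuclideanSpace ℝ (Fin n)) :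
    Set (EuclideanSpace ℝ (Fin n)) :=
  {v | ∀ y, f x + inner ℝ v (y - x) ≤ f y}

/-- Where a convex function is differentiable, its only subgradient is its gradient. -/
theorem subdifferential_eq_singleton {n : ℕ} {f : EuclideanSpace ℝ (Fin n) → ℝ}
    {x g : EuclideanSpace ℝ (Fin n)} (hf : ConvexOn ℝ Set.univ f) (hg : HasGradientAt f g x) :
    subdifferential f x = {g} := by
  have key : ∀ u : EuclideanSpace ℝ (Fin n),
      HasDerivAt (fun t : ℝ => f (x + t • u)) (inner ℝ g u) 0 := by
    intro u
    have h1 : HasDerivAt (fun t : ℝ => x + t • u) u 0 := by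
      simpa using ((hasDerivAt_id (0 : ℝ)).smul_const u).const_add x
    have h2 : HasFDerivAt f ((InnerProductSpace.toDual ℝ (EuclideanSpace ℝ (Fin n))) g)
        (x + (0 : ℝ) • u) := by simpa using hg.hasFDerivAt
    have h3 := h2.comp_hasDerivAt (0 : ℝ) h1
    simpa [Function.comp_def] using h3
  ext v
  simp only [subdifferential, Set.mem_ofPred_eq, Set.mem_singleton_iff]
  constructor
  · intro hv
    have hmin : ∀ u : EuclideanSpace ℝ (Fin n), inner ℝ g u - inner ℝ v u = 0 := by
      intro u
      have hd : HasDerivAt (fun t : ℝ => f (x + t • u) - t * inner ℝ v u)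
          (inner ℝ g u - inner ℝ v u) 0 := by
        have h := (key u).sub ((hasDerivAt_id (0 : ℝ)).mul_const (inner ℝ v u))
        rw [one_mul] at h
        exact h
      refine IsLocalMin.hasDerivAt_eq_zero (Filter.Eventually.of_forall fun t => ?_) hd
      have h := hv (x + t • u)
      simp only [add_sub_cancel_left, inner_smul_right] at h
      simp only [zero_smul, add_zero, zero_mul, sub_zero]
      linarith
    have h0 : inner ℝ (g - v) (g - v) = (0 : ℝ) := by
      have h := hmin (g - v)
      rwa [← inner_sub_left] at h
    exact (sub_eq_zero.mp (inner_self_eq_zero.mp h0)).symm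
  · rintro rfl y
    have hc : ConvexOn ℝ Set.univ (fun t : ℝ => f (x + t • (y - x))) := by
      refine ⟨convex_univ, fun a _ b _ s t hs ht hst => ?_⟩
      have h := hf.2 (Set.mem_univ (x + a • (y - x))) (Set.mem_univ (x + b • (y - x))) hs ht hst
      have e : s • (x + a • (y - x)) + t • (x + b • (y - x))
          = x + (s • a + t • b) • (y - x) := by
        obtain rfl : s = 1 - t := by linarith
        simp only [smul_eq_mul]
        module
      rw [e] at h
      exact h
    have h := hc.le_slope_of_hasDerivAt (Set.mem_univ (0 : ℝ)) (Set.mem_univ (1 : ℝ))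
      zero_lt_one (key (y - x))
    simp only [slope_def_field, one_smul, zero_smul, add_zero, sub_zero, div_one,
      add_sub_cancel] at h
    linarith

/-- The values of the billiard vector field on `∂(K × T)` away from `∂K × ∂T`:
`(-∇g_T(p), 0)` on `int K × ∂T` and `(0, ∇g_K(q))` on `∂K × int T`, where `g_K`, `g_T` are the
gauge functions.  At a point where a gauge is not differentiable, each of its subgradients is
allowed. -/
def fieldValues {n : ℕ} (K T : Set (EuclideanSpace ℝ (Fin n)))
    (z : EuclideanSpace ℝ (Fin n) × EuclideanSpace ℝ (Fin n)) :
    Set (EuclideanSpace ℝ (Fin n) × EuclideanSpace ℝ (Fin n)) :=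
  {u | (z.1 ∈ interior K ∧ z.2 ∈ frontier T ∧
          ∃ v ∈ subdifferential (gauge T) z.2, u = (-v, 0)) ∨
       (z.1 ∈ frontier K ∧ z.2 ∈ interior T ∧
          ∃ w ∈ subdifferential (gauge K) z.1, u = (0, w))}

/-- The cone of admissible one-sided velocities at a point `z = (q, p)` of `∂K × ∂T`:
the vectors `α (-∇g_T(p), 0) + β (0, ∇g_K(q))` with `α, β ≥ 0` not both zero. -/
def cornerCone {n : ℕ} (K T : Set (EuclideanSpace ℝ (Fin n)))
    (z : EuclideanSpace ℝ (Fin n) × EuclideanSpace ℝ (Fin n)) :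
    Set (EuclideanSpace ℝ (Fin n) × EuclideanSpace ℝ (Fin n)) :=
  {u | ∃ v ∈ subdifferential (gauge T) z.2, ∃ w ∈ subdifferential (gauge K) z.1,
        ∃ α β : ℝ, 0 ≤ α ∧ 0 ≤ β ∧ (α, β) ≠ (0, 0) ∧
          u = α • ((-v, 0) : EuclideanSpace ℝ (Fin n) × EuclideanSpace ℝ (Fin n)) +
              β • ((0, w) : EuclideanSpace ℝ (Fin n) × EuclideanSpace ℝ (Fin n))}

/-- A closed curve, given as a map on `ℝ` of period `1`, which is continuous and piecewise of
class `C^r`: the period splits into finitely many closed intervals on each of which the curve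
is `C^r` up to the end points. -/
structure IsPiecewiseSmoothLoop {F : Type*} [NormedAddCommGroup F] [NormedSpace ℝ F]
    (r : ℕ∞) (γ : ℝ → F) : Prop where
  continuous : Continuous γ
  periodic : Function.Periodic γ 1
  pieces : ∃ (N : ℕ) (s : ℕ → ℝ), StrictMono s ∧ s 0 = 0 ∧ s N = 1 ∧
    ∀ i < N, ContDiffOn ℝ r γ (Set.Icc (s i) (s (i + 1)))

/-- A closed `(K, T)`-billiard trajectory in `∂(K × T)`. -/
structure IsClosedTrajectory {n : ℕ} (r : ℕ∞) (K T : Set (EuclideanSpace ℝ (Fin n)))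
    (γ : ℝ → EuclideanSpace ℝ (Fin n) × EuclideanSpace ℝ (Fin n)) : Prop where
  loop : IsPiecewiseSmoothLoop r γ
  mem_frontier : ∀ t, γ t ∈ frontier (K ×ˢ T)
  /-- away from `∂K × ∂T` the curve follows the vector field at a constant positive rate -/
  follows_field : ∃ d : ℝ, 0 < d ∧ ∀ t, γ t ∉ frontier K ×ˢ frontier T →
    ∃ u ∈ fieldValues K T (γ t), HasDerivAt γ (d • u) t
  /-- on `∂K × ∂T` both one-sided velocities exist and lie in the corner cone -/
  corner : ∀ t, γ t ∈ frontier K ×ˢ frontier T →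
    (∃ u ∈ cornerCone K T (γ t), HasDerivWithinAt γ u (Set.Iic t) t) ∧
    (∃ u ∈ cornerCone K T (γ t), HasDerivWithinAt γ u (Set.Ici t) t)

/-- A periodic `T`-billiard trajectory in `K`: the projection to the position coordinate of a
closed `(K, T)`-billiard trajectory. -/
def IsPeriodicBilliardTrajectory {n : ℕ} (r : ℕ∞) (K T : Set (EuclideanSpace ℝ (Fin n)))
    (c : ℝ → EuclideanSpace ℝ (Fin n)) : Prop :=
  ∃ γ, IsClosedTrajectory r K T γ ∧ ∀ t, c t = (γ t).1

/-- The `‖·‖_K`-length of one period of a closed curve; `‖·‖_K` is the gauge function of `K`. -/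
def lengthK {n : ℕ} (K : Set (EuclideanSpace ℝ (Fin n))) (c : ℝ → EuclideanSpace ℝ (Fin n)) : ℝ :=
  ∫ t in (0 : ℝ)..1, gauge K (deriv c t)

/-- The closed curve `c` runs, during one period, exactly once through the two-bounce orbit
`[-q, q]`: it stays at `q` for a while, goes along the segment to `-q` at constant speed, stays
there for a while, and returns along the segment to `q` at constant speed.  (While the position
stays at a bounce point, the momentum moves.) -/
def IsTwoBounceOrbit {n : ℕ} (q : EuclideanSpace ℝ (Fin n))
    (c : ℝ → EuclideanSpace ℝ (Fin n)) : Prop :=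
  Function.Periodic c 1 ∧
  ∃ t₀ t₁ t₂ t₃ : ℝ, t₀ ≤ t₁ ∧ t₁ < t₂ ∧ t₂ ≤ t₃ ∧ t₃ < t₀ + 1 ∧
    (∀ t ∈ Set.Icc t₀ t₁, c t = q) ∧
    (∀ t ∈ Set.Icc t₁ t₂, c t = AffineMap.lineMap q (-q) ((t - t₁) / (t₂ - t₁))) ∧
    (∀ t ∈ Set.Icc t₂ t₃, c t = -q) ∧
    (∀ t ∈ Set.Icc t₃ (t₀ + 1), c t = AffineMap.lineMap (-q) q ((t - t₃) / (t₀ + 1 - t₃)))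

end MinkowskiBilliard

end

namespace MinkowskiBilliard

open Set Filter Topology

/-! Let `γ = (q, p)` be a closed trajectory and let `ℓ` be the length of its position curve.
Everything rests on a monotonicity argument: a periodic function with nonnegative right derivative
is constant (`right_deriv_eq_zero_of_periodic`). If the momentum were constant, `⟨q, p⟩` would
strictly decrease. So at some time the momentum moves, with velocity `β w`, `β ≠ 0`, where `w`
supports `K` at `q` (`exists_bounce`).

Let `m` be the midpoint of two points halving the curve. The curve lies in the ball of radius `ℓ /
4` about `m` (`gauge_sub_midpoint_le`). If `ℓ ≤ 4`, then `⟨q - m, w⟩ ≤ 1 = ⟨q, w⟩` at each time when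
the momentum moves. Hence `⟨p, m⟩` is nondecreasing, so it is constant and `⟨m, w⟩ = 0`
(`inner_center_eq_zero`). At a bounce `1 = ⟨q - m, w⟩ ≤ ℓ / 4`, so `ℓ ≥ 4`.

If `ℓ = 4`, start the halving at a bounce point `q₀`. Then `⟨m, w⟩ = 0` puts the other halving point
on the opposite supporting hyperplane, and strict convexity makes it `-q₀`. Each half has length
`2`, the distance between its end points, so by strict convexity it is the segment. The vector field
prescribes one constant speed in the interior, so rests occur only at `±q₀`.

Conversely, for `q ∈ ∂K` with a supporting covector `p`, the loop around the rectangle with corners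
`(±q, ±p)` is a trajectory projecting to the two-bounce orbit (`isClosedTrajectory_rectangleLoop`).
-/

/-- A symmetric convex body: compact, convex, symmetric, with the origin in its interior. -/
structure IsSymmetricBody {n : ℕ} (K : Set (EuclideanSpace ℝ (Fin n))) : Prop where
  isCompact : IsCompact K
  convex : Convex ℝ K
  mem_nhds : K ∈ 𝓝 0
  neg_mem : ∀ x ∈ K, -x ∈ K

theorem isSymmetricBody_of_strictConvex {n : ℕ} {K : Set (EuclideanSpace ℝ (Fin n))}
    (hcompact : IsCompact K) (hinterior : (interior K).Nonempty)
    (hsymm : ∀ x ∈ K, -x ∈ K) (hstrict : StrictConvex ℝ K) : IsSymmetricBody K := by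
  refine ⟨hcompact, hstrict.convex, ?_, hsymm⟩
  obtain ⟨x, hx⟩ := hinterior
  have h := hstrict.convex.combo_interior_self_mem_interior hx
    (hsymm x (interior_subset hx)) (a := 1 / 2) (b := 1 / 2) (by norm_num) (by norm_num)
    (by norm_num)
  have e : (1 / 2 : ℝ) • x + (1 / 2 : ℝ) • -x = 0 := by module
  rw [e] at h
  exact mem_interior_iff_mem_nhds.mp h

/-! ### Gauges, polar duality and strict convexity. -/

section Geometry

variable {n : ℕ} {K : Set (EuclideanSpace ℝ (Fin n))}

theorem inner_le_gauge (hK : K ∈ 𝓝 0) {w : EuclideanSpace ℝ (Fin n)}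
    (hw : ∀ q ∈ K, inner ℝ q w ≤ 1) (x : EuclideanSpace ℝ (Fin n)) :
    inner ℝ x w ≤ gauge K x := by
  refine le_of_forall_gt_imp_ge_of_dense fun a ha => ?_
  obtain ⟨b, hb, hba, y, hy, rfl⟩ := exists_lt_of_gauge_lt (absorbent_nhds_zero hK) ha
  have h := mul_le_mul_of_nonneg_left (hw y hy) hb.le
  simp only [real_inner_smul_left]
  linarith

theorem polarBody_mem_nhds (hK : Bornology.IsBounded K) : polarBody K ∈ 𝓝 0 := by
  obtain ⟨R, hR, hKR⟩ := hK.exists_pos_norm_le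
  refine mem_of_superset (Metric.ball_mem_nhds 0 (inv_pos.mpr hR)) fun p hp q hq => ?_
  rw [mem_ball_zero_iff] at hp
  calc inner ℝ q p ≤ ‖q‖ * ‖p‖ := real_inner_le_norm q p
    _ ≤ R * R⁻¹ := by gcongr; exact hKR q hq
    _ = 1 := mul_inv_cancel₀ hR.ne'

theorem convex_polarBody : Convex ℝ (polarBody K) := by
  intro x hx y hy a b ha hb hab q hq
  rw [inner_add_right, inner_smul_right, inner_smul_right]
  nlinarith [mul_le_mul_of_nonneg_left (hx q hq) ha, mul_le_mul_of_nonneg_left (hy q hq) hb]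

/-- Hahn–Banach separates the boundary point from the open convex set `interior K`; the functional
is positive at the point because `0` is interior, so it can be normalised there. -/
theorem exists_polar_inner_eq_one (hK : IsSymmetricBody K) {x : EuclideanSpace ℝ (Fin n)}
    (hx : gauge K x = 1) : ∃ w ∈ polarBody K, inner ℝ x w = 1 := by
  have h0 : (0 : EuclideanSpace ℝ (Fin n)) ∈ interior K := mem_interior_iff_mem_nhds.mpr hK.mem_nhds
  have hx' : x ∉ interior K := fun h => by
    rw [← gauge_lt_one_iff_mem_interior hK.convex hK.mem_nhds] at h
    linarith
  obtain ⟨f, hf⟩ := geometric_hahn_banach_open_point hK.convex.interior isOpen_interior hx'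
  have hpos : 0 < f x := by simpa using hf 0 h0
  have hle : ∀ q ∈ K, f q ≤ f x := by
    intro q hq
    have h1 : q ∈ closure (interior K) := by
      rw [hK.convex.closure_interior_eq_closure_of_nonempty_interior ⟨0, h0⟩]
      exact subset_closure hq
    exact closure_minimal (t := {q | f q ≤ f x}) (fun y hy => (hf y hy).le)
      (isClosed_le f.continuous continuous_const) h1
  have key : ∀ y, inner ℝ y ((f x)⁻¹ • (InnerProductSpace.toDual ℝ _).symm f) = (f x)⁻¹ * f y := by
    intro y
    rw [inner_smul_right, real_inner_comm, InnerProductSpace.toDual_symm_apply]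
  refine ⟨(f x)⁻¹ • (InnerProductSpace.toDual ℝ _).symm f, fun q hq => ?_, ?_⟩
  · rw [key, ← inv_mul_cancel₀ hpos.ne']
    exact mul_le_mul_of_nonneg_left (hle q hq) (inv_pos.mpr hpos).le
  · rw [key, inv_mul_cancel₀ hpos.ne']

theorem IsSymmetricBody.gauge_smul (hK : IsSymmetricBody K) (a : ℝ)
    (x : EuclideanSpace ℝ (Fin n)) : gauge K (a • x) = |a| * gauge K x := by
  rcases le_total 0 a with h | h
  · rw [gauge_smul_of_nonneg h, abs_of_nonneg h, smul_eq_mul]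
  · rw [show a • x = -((-a) • x) by module, gauge_neg hK.neg_mem,
      gauge_smul_of_nonneg (neg_nonneg.mpr h), abs_of_nonpos h, smul_eq_mul]

theorem IsSymmetricBody.gauge_add_le (hK : IsSymmetricBody K) (x y : EuclideanSpace ℝ (Fin n)) :
    gauge K (x + y) ≤ gauge K x + gauge K y :=
  _root_.gauge_add_le hK.convex (absorbent_nhds_zero hK.mem_nhds) x y

theorem IsSymmetricBody.gauge_pos (hK : IsSymmetricBody K) {x : EuclideanSpace ℝ (Fin n)} :
    0 < gauge K x ↔ x ≠ 0 :=
  _root_.gauge_pos (absorbent_nhds_zero hK.mem_nhds)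
    ((NormedSpace.isVonNBounded_iff ℝ).mpr hK.isCompact.isBounded)

theorem IsSymmetricBody.eq_zero_of_gauge_nonpos (hK : IsSymmetricBody K)
    {x : EuclideanSpace ℝ (Fin n)} (hx : gauge K x ≤ 0) : x = 0 := by
  by_contra h
  exact absurd (hK.gauge_pos.mpr h) hx.not_gt

theorem IsSymmetricBody.gauge_le_one_iff (hK : IsSymmetricBody K)
    {x : EuclideanSpace ℝ (Fin n)} : gauge K x ≤ 1 ↔ x ∈ K := by
  rw [gauge_le_one_iff_mem_closure hK.convex hK.mem_nhds, hK.isCompact.isClosed.closure_eq]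

theorem IsSymmetricBody.gauge_eq_one_iff (hK : IsSymmetricBody K)
    {x : EuclideanSpace ℝ (Fin n)} : gauge K x = 1 ↔ x ∈ frontier K :=
  gauge_eq_one_iff_mem_frontier hK.convex hK.mem_nhds

theorem IsSymmetricBody.gauge_lt_one_iff (hK : IsSymmetricBody K)
    {x : EuclideanSpace ℝ (Fin n)} : gauge K x < 1 ↔ x ∈ interior K :=
  gauge_lt_one_iff_mem_interior hK.convex hK.mem_nhds

theorem exists_polar_inner_eq_gauge (hK : IsSymmetricBody K) {x : EuclideanSpace ℝ (Fin n)}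
    (hx : x ≠ 0) : ∃ w ∈ polarBody K, inner ℝ x w = gauge K x := by
  have hpos := hK.gauge_pos.mpr hx
  obtain ⟨w, hw, h⟩ := exists_polar_inner_eq_one hK (x := (gauge K x)⁻¹ • x) (by
    rw [hK.gauge_smul, abs_of_pos (inv_pos.mpr hpos), inv_mul_cancel₀ hpos.ne'])
  refine ⟨w, hw, ?_⟩
  rw [real_inner_smul_left] at h
  field_simp at h
  exact h

/-- Bipolarity, in the form that reduces norm estimates to estimates for scalar functions. -/
theorem gauge_le_of_forall_polar (hK : IsSymmetricBody K) {x : EuclideanSpace ℝ (Fin n)} {a : ℝ}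
    (ha : 0 ≤ a) (h : ∀ w ∈ polarBody K, inner ℝ x w ≤ a) : gauge K x ≤ a := by
  by_cases hx : x = 0
  · rwa [hx, gauge_zero]
  · obtain ⟨w, hw, e⟩ := exists_polar_inner_eq_gauge hK hx
    exact e ▸ h w hw

/-- Subgradients of a gauge at a boundary point support the body there. -/
theorem inner_le_of_mem_subdifferential_gauge {C : Set (EuclideanSpace ℝ (Fin n))}
    {x v : EuclideanSpace ℝ (Fin n)} (hx : gauge C x = 1) (hv : v ∈ subdifferential (gauge C) x) :
    inner ℝ v x = 1 ∧ ∀ y, inner ℝ v y ≤ gauge C y := by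
  -- By homogeneity the tests at `0` and at `2x` bound `⟨v, x⟩` by `1` from below and from above.
  have h0 := hv 0
  have h2 := hv ((2 : ℝ) • x)
  rw [gauge_zero, hx, inner_sub_right, inner_zero_right] at h0
  rw [gauge_smul_of_nonneg (by norm_num), hx, inner_sub_right, inner_smul_right, smul_eq_mul] at h2
  have e : inner ℝ v x = 1 := by linarith
  refine ⟨e, fun y => ?_⟩
  have h := hv y
  rw [hx, inner_sub_right, e] at h
  linarith

theorem mem_subdifferential_gauge {C : Set (EuclideanSpace ℝ (Fin n))}
    {x v : EuclideanSpace ℝ (Fin n)} (hx : gauge C x = 1) (hvx : inner ℝ v x = 1)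
    (hv : ∀ y, inner ℝ v y ≤ gauge C y) : v ∈ subdifferential (gauge C) x := by
  intro y
  rw [hx, inner_sub_right, hvx]
  linarith [hv y]

theorem isClosed_polarBody : IsClosed (polarBody K) := by
  have : polarBody K = ⋂ q ∈ K, {p | inner ℝ q p ≤ 1} := by
    ext p
    simp [polarBody]
  rw [this]
  exact isClosed_biInter fun q _ => isClosed_le (by fun_prop) continuous_const

theorem isBounded_polarBody (hK : K ∈ 𝓝 0) : Bornology.IsBounded (polarBody K) := by
  obtain ⟨δ, hδ, hsub⟩ := Metric.nhds_basis_closedBall.mem_iff.mp hK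
  refine isBounded_iff_forall_norm_le.mpr ⟨δ⁻¹, fun p hp => ?_⟩
  by_cases h0 : p = 0
  · rw [h0, norm_zero]
    positivity
  have hpos : 0 < ‖p‖ := norm_pos_iff.mpr h0
  have h := hp ((δ * ‖p‖⁻¹) • p) (hsub (by
    rw [mem_closedBall_zero_iff, norm_smul, Real.norm_of_nonneg (by positivity)]
    field_simp
    exact le_rfl))
  rw [real_inner_smul_left, real_inner_self_eq_norm_sq] at h
  rw [le_inv_comm₀ hpos hδ, ← one_div, le_div_iff₀ hpos]
  calc δ * ‖p‖ = δ * ‖p‖⁻¹ * ‖p‖ ^ 2 := by field_simp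
    _ ≤ 1 := h

theorem IsSymmetricBody.polarBody (hK : IsSymmetricBody K) : IsSymmetricBody (polarBody K) where
  isCompact := Metric.isCompact_of_isClosed_isBounded isClosed_polarBody
    (isBounded_polarBody hK.mem_nhds)
  convex := convex_polarBody
  mem_nhds := polarBody_mem_nhds hK.isCompact.isBounded
  neg_mem p hp q hq := by
    have h := hp (-q) (hK.neg_mem q hq)
    rwa [inner_neg_left, ← inner_neg_right] at h

/-- Bipolarity puts every subgradient of `g_T` on `∂K`, so the flight speed in the norm of `K` is
the rate of the vector field. -/
theorem of_mem_subdifferential_gauge_polarBody (hK : IsSymmetricBody K)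
    {p v : EuclideanSpace ℝ (Fin n)} (hp : p ∈ frontier (polarBody K))
    (hv : v ∈ subdifferential (gauge (polarBody K)) p) :
    gauge K v = 1 ∧ inner ℝ v p = 1 := by
  rw [← hK.polarBody.gauge_eq_one_iff] at hp
  obtain ⟨h1, h2⟩ := inner_le_of_mem_subdifferential_gauge hp hv
  refine ⟨le_antisymm (gauge_le_of_forall_polar hK zero_le_one fun w hw =>
    (h2 w).trans (gauge_le_one_of_mem hw)) ?_, h1⟩
  have hT : p ∈ polarBody K := hK.polarBody.gauge_le_one_iff.mp hp.le
  exact h1 ▸ inner_le_gauge hK.mem_nhds hT v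

theorem of_mem_subdifferential_gauge (hK : IsSymmetricBody K)
    {q w : EuclideanSpace ℝ (Fin n)} (hq : q ∈ frontier K)
    (hw : w ∈ subdifferential (gauge K) q) : w ∈ polarBody K ∧ inner ℝ q w = 1 := by
  rw [← hK.gauge_eq_one_iff] at hq
  obtain ⟨h1, h2⟩ := inner_le_of_mem_subdifferential_gauge hq hw
  refine ⟨fun y hy => ?_, by rw [real_inner_comm, h1]⟩
  rw [real_inner_comm]
  exact (h2 y).trans (gauge_le_one_of_mem hy)

/-- In a strictly convex norm the balls of radii `s`, `2 - s` about `a`, `-a` with `‖a‖ = 1` meet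
in one point only. -/
theorem eq_smul_of_gauge_le (hK : IsSymmetricBody K) (hstrict : StrictConvex ℝ K)
    {a z : EuclideanSpace ℝ (Fin n)} {s : ℝ} (ha : gauge K a = 1)
    (h1 : gauge K (a - z) ≤ s) (h2 : gauge K (z + a) ≤ 2 - s) : z = (1 - s) • a := by
  have hs0 : 0 ≤ s := (gauge_nonneg _).trans h1
  have hs2 : 0 ≤ 2 - s := (gauge_nonneg _).trans h2
  rcases hs0.eq_or_lt with h | hpos
  · have := hK.eq_zero_of_gauge_nonpos (h1.trans h.ge)
    rw [← h, sub_zero, one_smul]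
    exact (sub_eq_zero.mp this).symm
  rcases hs2.eq_or_lt with h | hpos2
  · have := hK.eq_zero_of_gauge_nonpos (h2.trans h.ge)
    rw [show (1 - s) = -1 by linarith, neg_smul, one_smul]
    exact eq_neg_of_add_eq_zero_left this
  have hx : s⁻¹ • (a - z) ∈ K := by
    rw [← hK.gauge_le_one_iff, hK.gauge_smul, abs_of_pos (inv_pos.mpr hpos)]
    calc s⁻¹ * gauge K (a - z) ≤ s⁻¹ * s := by gcongr
      _ = 1 := inv_mul_cancel₀ hpos.ne'
  have hy : (2 - s)⁻¹ • (z + a) ∈ K := by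
    rw [← hK.gauge_le_one_iff, hK.gauge_smul, abs_of_pos (inv_pos.mpr hpos2)]
    calc (2 - s)⁻¹ * gauge K (z + a) ≤ (2 - s)⁻¹ * (2 - s) := by gcongr
      _ = 1 := inv_mul_cancel₀ hpos2.ne'
  -- The boundary point `a` is a convex combination of two points of `K` with positive weights, so
  -- strict convexity forces them to coincide.
  have hcombo : (s / 2) • s⁻¹ • (a - z) + ((2 - s) / 2) • (2 - s)⁻¹ • (z + a) = a := by
    rw [smul_smul, smul_smul, show s / 2 * s⁻¹ = 1 / 2 by field_simp,
      show (2 - s) / 2 * (2 - s)⁻¹ = 1 / 2 by field_simp]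
    module
  have heq : s⁻¹ • (a - z) = (2 - s)⁻¹ • (z + a) := by
    by_contra hne
    have h := hstrict hx hy hne (a := s / 2) (b := (2 - s) / 2) (by positivity) (by positivity)
      (by ring)
    rw [hcombo, ← hK.gauge_lt_one_iff, ha] at h
    exact lt_irrefl _ h
  have h3 : (2 - s) • (a - z) = s • (z + a) := by
    have := congrArg (fun v => (s * (2 - s)) • v) heq
    simp only [smul_smul] at this
    rwa [show s * (2 - s) * s⁻¹ = 2 - s by field_simp,
      show s * (2 - s) * (2 - s)⁻¹ = s by field_simp] at this
  have h4 : (2 : ℝ) • z = (2 : ℝ) • ((1 - s) • a) := by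
    rw [← sub_eq_zero] at h3 ⊢
    rw [← neg_eq_zero, ← h3]
    module
  exact smul_right_injective _ (two_ne_zero) h4

/-- Two points of `K` at distance `2` are antipodal. -/
theorem eq_neg_of_two_le_gauge_sub (hK : IsSymmetricBody K) (hstrict : StrictConvex ℝ K)
    {a b : EuclideanSpace ℝ (Fin n)} (ha : a ∈ K) (hb : b ∈ K) (h : 2 ≤ gauge K (a - b)) :
    b = -a := by
  by_contra hne
  have hne' : a ≠ -b := fun e => hne (by rw [e, neg_neg])
  have h1 := hstrict ha (hK.neg_mem b hb) hne' (a := 1 / 2) (b := 1 / 2) (by norm_num)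
    (by norm_num) (by norm_num)
  rw [← smul_add, ← sub_eq_add_neg] at h1
  rw [← hK.gauge_lt_one_iff, hK.gauge_smul, abs_of_pos (by norm_num)] at h1
  linarith

end Geometry

/-! ### Periodic functions and piecewise smooth loops. -/

section Loops

variable {F : Type*} [NormedAddCommGroup F] [NormedSpace ℝ F]

/-- A continuous periodic function whose right derivative is nonnegative has vanishing right
derivative. -/
theorem right_deriv_eq_zero_of_periodic {f f' : ℝ → ℝ} (hf : Continuous f)
    (hper : Function.Periodic f 1) (hd : ∀ t, HasDerivWithinAt f (f' t) (Ici t) t)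
    (h0 : ∀ t, 0 ≤ f' t) (t : ℝ) : f' t = 0 := by
  have hmono : Monotone f := fun a b hab =>
    image_le_of_deriv_right_le_deriv_boundary (f := fun _ => f a) (f' := fun _ => 0)
      continuousOn_const (fun x _ => hasDerivWithinAt_const x _ _) le_rfl hf.continuousOn
      (fun x _ => hd x) (fun x _ => h0 x) ⟨hab, le_rfl⟩
  -- Monotonicity squeezes `f` on `[t, t + 1]` between its equal values at the ends.
  have hc : f =ᶠ[𝓝[≥] t] fun _ => f t := by
    filter_upwards [Icc_mem_nhdsGE (lt_add_one t)] with s hs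
    exact le_antisymm ((hmono hs.2).trans (hper t).le) (hmono hs.1)
  have h := (hasDerivWithinAt_const t (Ici t) (f t)).congr_of_eventuallyEq hc rfl
  exact (uniqueDiffWithinAt_Ici t).eq_deriv _ (hd t) h

theorem exists_mem_Ico_of_lt {s : ℕ → ℝ} {x : ℝ} (h0 : s 0 ≤ x) :
    ∀ N : ℕ, x < s N → ∃ i < N, x ∈ Ico (s i) (s (i + 1))
  | 0, h => absurd h0 h.not_ge
  | N + 1, h => by
    rcases lt_or_ge x (s N) with h' | h'
    · obtain ⟨i, hi, hx⟩ := exists_mem_Ico_of_lt h0 N h'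
      exact ⟨i, hi.trans N.lt_succ_self, hx⟩
    · exact ⟨N, N.lt_succ_self, h', h⟩

theorem IsPiecewiseSmoothLoop.fst {G : Type*} [NormedAddCommGroup G] [NormedSpace ℝ G] {r : ℕ∞}
    {γ : ℝ → F × G} (h : IsPiecewiseSmoothLoop r γ) :
    IsPiecewiseSmoothLoop r fun t => (γ t).1 := by
  refine ⟨h.continuous.fst, fun t => by simp only [h.periodic t], ?_⟩
  obtain ⟨N, s, h1, h2, h3, h4⟩ := h.pieces
  exact ⟨N, s, h1, h2, h3, fun i hi => (h4 i hi).fst⟩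

theorem periodic_deriv {c : ℝ → F} (h : Function.Periodic c 1) :
    Function.Periodic (deriv c) 1 := fun t => by
  rw [← deriv_comp_add_const c 1 t]
  congr 1
  exact funext h

/-- Differentiability can fail only at integer translates of the break points. -/
theorem IsPiecewiseSmoothLoop.countable_not_differentiableAt {r : ℕ∞} (hr : 1 ≤ r) {c : ℝ → F}
    (h : IsPiecewiseSmoothLoop r c) : {t | ¬ DifferentiableAt ℝ c t}.Countable := by
  obtain ⟨N, s, h1, h2, h3, h4⟩ := h.pieces
  refine (countable_range fun x : ℕ × ℤ => s x.1 + x.2).mono fun t ht => ?_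
  by_contra hn
  apply ht
  have hs : ∀ i, Int.fract t ≠ s i := fun i e => hn ⟨(i, ⌊t⌋), by
    simp only [← e, Int.fract_add_floor]⟩
  obtain ⟨i, hi, hx⟩ := exists_mem_Ico_of_lt (x := Int.fract t) (h2 ▸ Int.fract_nonneg t) N
    (h3 ▸ Int.fract_lt_one t)
  have hd : DifferentiableAt ℝ c (Int.fract t) :=
    ((h4 i hi).differentiableOn (by exact_mod_cast (zero_lt_one.trans_le hr).ne')).differentiableAt
      (Icc_mem_nhds (lt_of_le_of_ne hx.1 (hs i).symm) hx.2)
  have e : c = fun x => c (x - ⌊t⌋) := by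
    funext x
    have := (h.periodic.int_mul ⌊t⌋).sub_eq x
    rw [mul_one] at this
    exact this.symm
  rw [e]
  exact DifferentiableAt.comp t (g := c) (f := fun x => x - (⌊t⌋ : ℝ)) hd (by fun_prop)

/-- On each closed piece the one-sided derivative is continuous, and it agrees with `deriv` in the
interior. -/
theorem IsPiecewiseSmoothLoop.intervalIntegrable_comp_deriv {G : Type*} [NormedAddCommGroup G]
    {r : ℕ∞} (hr : 1 ≤ r) {c : ℝ → F} (h : IsPiecewiseSmoothLoop r c) {g : F → G}
    (hg : Continuous g) (a b : ℝ) :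
    IntervalIntegrable (fun t => g (deriv c t)) MeasureTheory.volume a b := by
  refine Function.Periodic.intervalIntegrable₀ (T := 1)
    (fun t => by simp only [periodic_deriv h.periodic t]) one_ne_zero ?_ a b
  obtain ⟨N, s, h1, h2, h3, h4⟩ := h.pieces
  rw [← h2, ← h3]
  refine IntervalIntegrable.trans_iterate fun i hi => ?_
  have hlt : s i < s (i + 1) := h1 i.lt_succ_self
  have hc : ContinuousOn (derivWithin c (Icc (s i) (s (i + 1)))) (Icc (s i) (s (i + 1))) :=
    (h4 i hi).continuousOn_derivWithin (uniqueDiffOn_Icc hlt) (by exact_mod_cast hr)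
  refine IntervalIntegrable.congr_uIoo (f := fun t => g (derivWithin c (Icc (s i) (s (i + 1))) t))
    ?_ fun t ht => ?_
  · apply ContinuousOn.intervalIntegrable
    rw [uIcc_of_le hlt.le]
    exact hg.comp_continuousOn hc
  · rw [uIoo_of_le hlt.le] at ht
    simp only [derivWithin_of_mem_nhds (Icc_mem_nhds ht.1 ht.2)]

end Loops

/-! ### Arc length in the norm with unit ball `K`. -/

section ArcLength

variable {n : ℕ} {K : Set (EuclideanSpace ℝ (Fin n))} {r : ℕ∞} {c : ℝ → EuclideanSpace ℝ (Fin n)}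

/-- The arc length in the norm with unit ball `K`, measured from the parameter `0`. -/
noncomputable def arcLength (K : Set (EuclideanSpace ℝ (Fin n))) (c : ℝ → EuclideanSpace ℝ (Fin n)) (t : ℝ) : ℝ :=
  ∫ x in (0 : ℝ)..t, gauge K (deriv c x)

theorem intervalIntegrable_gauge_deriv (hK : IsSymmetricBody K) (hr : 1 ≤ r)
    (hc : IsPiecewiseSmoothLoop r c) (a b : ℝ) :
    IntervalIntegrable (fun t => gauge K (deriv c t)) MeasureTheory.volume a b :=
  hc.intervalIntegrable_comp_deriv hr (continuous_gauge hK.convex hK.mem_nhds) a b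

theorem arcLength_sub (hK : IsSymmetricBody K) (hr : 1 ≤ r) (hc : IsPiecewiseSmoothLoop r c)
    (s t : ℝ) : arcLength K c t - arcLength K c s = ∫ x in s..t, gauge K (deriv c x) :=
  intervalIntegral.integral_interval_sub_left (intervalIntegrable_gauge_deriv hK hr hc _ _)
    (intervalIntegrable_gauge_deriv hK hr hc _ _)

theorem monotone_arcLength (hK : IsSymmetricBody K) (hr : 1 ≤ r)
    (hc : IsPiecewiseSmoothLoop r c) : Monotone (arcLength K c) := fun s t hst => by
  rw [← sub_nonneg, arcLength_sub hK hr hc]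
  exact intervalIntegral.integral_nonneg hst fun _ _ => gauge_nonneg _

theorem continuous_arcLength (hK : IsSymmetricBody K) (hr : 1 ≤ r)
    (hc : IsPiecewiseSmoothLoop r c) : Continuous (arcLength K c) :=
  intervalIntegral.continuous_primitive (intervalIntegrable_gauge_deriv hK hr hc) 0

theorem arcLength_add_one (hK : IsSymmetricBody K) (hr : 1 ≤ r)
    (hc : IsPiecewiseSmoothLoop r c) (t : ℝ) :
    arcLength K c (t + 1) = arcLength K c t + lengthK K c := by
  have hper : Function.Periodic (fun t => gauge K (deriv c t)) 1 := fun t => by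
    simp only [periodic_deriv hc.periodic t]
  have h := hper.intervalIntegral_add_eq t 0
  rw [← arcLength_sub hK hr hc, zero_add] at h
  rw [lengthK, ← h]
  ring

/-- Pair the curve with a polar covector, apply the fundamental theorem of calculus off a countable
set, and bound the integrand by the gauge of the velocity. -/
theorem gauge_sub_le_arcLength (hK : IsSymmetricBody K) (hr : 1 ≤ r)
    (hc : IsPiecewiseSmoothLoop r c) (s t : ℝ) :
    gauge K (c t - c s) ≤ |arcLength K c t - arcLength K c s| := by
  wlog hst : s ≤ t generalizing s t
  · rw [← gauge_neg hK.neg_mem, neg_sub, abs_sub_comm]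
    exact this t s (le_of_not_ge hst)
  rw [abs_of_nonneg (sub_nonneg.mpr (monotone_arcLength hK hr hc hst))]
  refine gauge_le_of_forall_polar hK (sub_nonneg.mpr (monotone_arcLength hK hr hc hst))
    fun w hw => ?_
  have hint : IntervalIntegrable (fun t => inner ℝ (deriv c t) w) MeasureTheory.volume s t :=
    hc.intervalIntegrable_comp_deriv hr (g := fun x => inner ℝ x w) (by fun_prop) s t
  have h := MeasureTheory.integral_eq_of_hasDerivAt_off_countable (fun t => inner ℝ (c t) w)
    (fun t => inner ℝ (deriv c t) w) (hc.countable_not_differentiableAt hr)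
    (hc.continuous.inner continuous_const).continuousOn (fun x hx => by
      have hd : DifferentiableAt ℝ c x := not_not.mp hx.2
      simpa using hd.hasDerivAt.inner ℝ (hasDerivAt_const x w)) hint
  rw [inner_sub_left, ← h, arcLength_sub hK hr hc]
  exact intervalIntegral.integral_mono_on hst hint (intervalIntegrable_gauge_deriv hK hr hc s t)
    fun x _ => inner_le_gauge hK.mem_nhds hw _

/-- A closed curve of length `ℓ` lies in the ball of radius `ℓ / 4` about the midpoint of two
points that halve it. -/
theorem gauge_sub_midpoint_le (hK : IsSymmetricBody K) (hr : 1 ≤ r)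
    (hc : IsPiecewiseSmoothLoop r c) {t₀ t₁ : ℝ}
    (h1 : arcLength K c t₁ = arcLength K c t₀ + lengthK K c / 2) (t : ℝ) :
    gauge K (c t - (1 / 2 : ℝ) • (c t₀ + c t₁)) ≤ lengthK K c / 4 := by
  -- A point on either half has total distance at most `ℓ / 2` to the two ends of that half;
  -- averaging the two difference vectors gives `ℓ / 4`.
  suffices h : gauge K (c t - c t₀) + gauge K (c t - c t₁) ≤ lengthK K c / 2 by
    have e : c t - (1 / 2 : ℝ) • (c t₀ + c t₁) = (1 / 2 : ℝ) • ((c t - c t₀) + (c t - c t₁)) := by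
      module
    rw [e, hK.gauge_smul, abs_of_pos (by norm_num)]
    linarith [hK.gauge_add_le (c t - c t₀) (c t - c t₁)]
  obtain ⟨t', ht', e⟩ := hc.periodic.exists_mem_Ico one_pos t t₀
  rw [e]
  have hmono := monotone_arcLength hK hr hc
  have hL : 0 ≤ lengthK K c := by
    have := hmono (show (0 : ℝ) ≤ 0 + 1 by norm_num)
    rw [arcLength_add_one hK hr hc] at this
    linarith
  have h0 := hmono ht'.1
  have h2 := hmono ht'.2.le
  rw [arcLength_add_one hK hr hc] at h2
  rcases le_total (arcLength K c t') (arcLength K c t₁) with h | h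
  · have a1 := gauge_sub_le_arcLength hK hr hc t₀ t'
    have a2 := gauge_sub_le_arcLength hK hr hc t₁ t'
    rw [abs_of_nonneg (by linarith)] at a1
    rw [abs_of_nonpos (by linarith)] at a2
    linarith
  · have a1 := gauge_sub_le_arcLength hK hr hc (t₀ + 1) t'
    have a2 := gauge_sub_le_arcLength hK hr hc t₁ t'
    rw [arcLength_add_one hK hr hc, hc.periodic t₀, abs_of_nonpos (by linarith)] at a1
    rw [abs_of_nonneg (by linarith)] at a2
    linarith

theorem exists_arcLength_eq_add (hK : IsSymmetricBody K) (hr : 1 ≤ r)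
    (hc : IsPiecewiseSmoothLoop r c) (t₀ : ℝ) {s : ℝ} (hs : s ∈ Icc 0 (lengthK K c)) :
    ∃ t, arcLength K c t = arcLength K c t₀ + s := by
  have h := intermediate_value_Icc (show t₀ ≤ t₀ + 1 by linarith)
    (continuous_arcLength hK hr hc).continuousOn
  rw [arcLength_add_one hK hr hc] at h
  obtain ⟨t, -, ht⟩ := h ⟨le_add_of_nonneg_right hs.1, add_le_add_right hs.2 _⟩
  exact ⟨t, ht⟩

theorem lengthK_nonneg (K : Set (EuclideanSpace ℝ (Fin n))) (c : ℝ → EuclideanSpace ℝ (Fin n)) :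
    0 ≤ lengthK K c :=
  intervalIntegral.integral_nonneg zero_le_one fun _ _ => gauge_nonneg _

end ArcLength

/-! ### Monotone quantities along closed trajectories and the length bound. -/

section Trajectories

theorem hasDerivWithinAt_fst {F G : Type*} [NormedAddCommGroup F] [NormedSpace ℝ F]
    [NormedAddCommGroup G] [NormedSpace ℝ G] {f : ℝ → F × G} {u : F × G} {s : Set ℝ} {t : ℝ}
    (h : HasDerivWithinAt f u s t) : HasDerivWithinAt (fun x => (f x).1) u.1 s t :=
  (ContinuousLinearMap.fst ℝ F G).hasFDerivAt.comp_hasDerivWithinAt t h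

theorem hasDerivWithinAt_snd {F G : Type*} [NormedAddCommGroup F] [NormedSpace ℝ F]
    [NormedAddCommGroup G] [NormedSpace ℝ G] {f : ℝ → F × G} {u : F × G} {s : Set ℝ} {t : ℝ}
    (h : HasDerivWithinAt f u s t) : HasDerivWithinAt (fun x => (f x).2) u.2 s t :=
  (ContinuousLinearMap.snd ℝ F G).hasFDerivAt.comp_hasDerivWithinAt t h

variable {n : ℕ} {K : Set (EuclideanSpace ℝ (Fin n))} {r : ℕ∞}
  {γ : ℝ → EuclideanSpace ℝ (Fin n) × EuclideanSpace ℝ (Fin n)}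

/-- The right velocity of a closed trajectory, with the supporting properties of the two
subgradients in it. -/
theorem IsClosedTrajectory.exists_right_velocity (hK : IsSymmetricBody K)
    (hγ : IsClosedTrajectory r K (polarBody K) γ) (t : ℝ) :
    ∃ (v w : EuclideanSpace ℝ (Fin n)) (α β : ℝ), 0 ≤ α ∧ 0 ≤ β ∧ (α ≠ 0 ∨ β ≠ 0) ∧
      HasDerivWithinAt (fun s => (γ s).1) (-(α • v)) (Ici t) t ∧
      HasDerivWithinAt (fun s => (γ s).2) (β • w) (Ici t) t ∧
      (α ≠ 0 → inner ℝ v (γ t).2 = 1) ∧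
      (β ≠ 0 → (γ t).1 ∈ frontier K ∧ w ∈ polarBody K ∧ inner ℝ (γ t).1 w = 1) := by
  by_cases h : γ t ∈ frontier K ×ˢ frontier (polarBody K)
  · obtain ⟨-, u, ⟨v, hv, w, hw, α, β, hα, hβ, hne, rfl⟩, hd⟩ := hγ.corner t h
    refine ⟨v, w, α, β, hα, hβ, ?_, ?_, ?_, fun _ =>
      (of_mem_subdifferential_gauge_polarBody hK h.2 hv).2, fun _ =>
      ⟨h.1, of_mem_subdifferential_gauge hK h.1 hw⟩⟩
    · by_contra! h0
      exact hne (by rw [h0.1, h0.2])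
    · simpa using hasDerivWithinAt_fst hd
    · simpa using hasDerivWithinAt_snd hd
  · obtain ⟨d, hd0, hd⟩ := hγ.follows_field
    obtain ⟨u, hu, hder⟩ := hd t h
    have h1 := hder.hasDerivWithinAt (s := Ici t)
    rcases hu with ⟨-, hp, v, hv, rfl⟩ | ⟨hq, -, w, hw, rfl⟩
    -- Off the corners one coefficient is zero; its vector is the dummy `0`, whose supporting
    -- property is only claimed for a nonzero coefficient.
    · refine ⟨v, 0, d, 0, hd0.le, le_rfl, Or.inl hd0.ne', by simpa using hasDerivWithinAt_fst h1,
        by simpa using hasDerivWithinAt_snd h1, fun _ => (of_mem_subdifferential_gauge_polarBody hK hp hv).2,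
        fun h0 => absurd rfl h0⟩
    · exact ⟨0, w, 0, d, le_rfl, hd0.le, Or.inr hd0.ne', by simpa using hasDerivWithinAt_fst h1,
        by simpa using hasDerivWithinAt_snd h1, fun h0 => absurd rfl h0,
        fun _ => ⟨hq, of_mem_subdifferential_gauge hK hq hw⟩⟩

theorem IsClosedTrajectory.continuous_snd (hγ : IsClosedTrajectory r K (polarBody K) γ) :
    Continuous fun t => (γ t).2 := hγ.loop.continuous.snd

/-- The momentum of a closed trajectory is not constant. -/
theorem IsClosedTrajectory.exists_right_deriv_snd_ne_zero (hK : IsSymmetricBody K)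
    (hγ : IsClosedTrajectory r K (polarBody K) γ) :
    ∃ t, ¬ HasDerivWithinAt (fun s => (γ s).2) 0 (Ici t) t := by
  by_contra! h0
  have hconst : ∀ t, 0 ≤ t → (γ t).2 = (γ 0).2 := fun t ht =>
    constant_of_has_deriv_right_zero hγ.continuous_snd.continuousOn (fun x _ => h0 x) t ⟨ht, le_rfl⟩
  have hper : Function.Periodic (fun t => (γ t).2) 1 := fun t => by simp only [hγ.loop.periodic t]
  have hconst' : ∀ t, (γ t).2 = (γ 0).2 := fun t => by
    obtain ⟨s, hs, e⟩ := hper.exists_mem_Ico₀ one_pos t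
    exact e.trans (hconst s hs.1)
  choose v w α β hα hβ hne hq hp hv hw using hγ.exists_right_velocity hK
  have hβ0 : ∀ t, β t = 0 := by
    intro t
    by_contra hb
    have e := (uniqueDiffWithinAt_Ici t).eq_deriv _ (hp t) (h0 t)
    have h1 := (hw t hb).2.2
    rw [(smul_eq_zero.mp e).resolve_left hb, inner_zero_right] at h1
    exact zero_ne_one h1
  have hα0 : ∀ t, α t ≠ 0 := fun t => (hne t).resolve_right fun h => h (hβ0 t)
  -- With the momentum frozen at `p₀`, `-⟨q, p₀⟩` grows at rate `α`, which never vanishes.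
  have h := right_deriv_eq_zero_of_periodic (f := fun t => -inner ℝ (γ t).1 (γ 0).2) (f' := α)
    (hγ.loop.continuous.fst.inner continuous_const).neg
    (fun t => by simp only [hγ.loop.periodic t])
    (fun t => by
      have h1 := ((hq t).inner ℝ (hasDerivWithinAt_const t _ (γ 0).2)).fun_neg
      have h2 := hv t (hα0 t)
      rw [hconst' t] at h2
      simpa [inner_neg_left, real_inner_smul_left, h2] using h1) hα 0
  exact hα0 0 h

theorem IsClosedTrajectory.exists_bounce (hK : IsSymmetricBody K)
    (hγ : IsClosedTrajectory r K (polarBody K) γ) :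
    ∃ (t β : ℝ) (w : EuclideanSpace ℝ (Fin n)), β ≠ 0 ∧ HasDerivWithinAt (fun s => (γ s).2) (β • w) (Ici t) t ∧
      (γ t).1 ∈ frontier K ∧ w ∈ polarBody K ∧ inner ℝ (γ t).1 w = (1 : ℝ) := by
  obtain ⟨t, ht⟩ := hγ.exists_right_deriv_snd_ne_zero hK
  obtain ⟨v, w, α, β, -, -, -, -, hp, -, hw⟩ := hγ.exists_right_velocity hK t
  have hb : β ≠ 0 := fun hb => ht (by simpa [hb] using hp)
  exact ⟨t, β, w, hb, hp, hw hb⟩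

/-- If the position of a closed trajectory stays in the unit ball about `m`, then the velocity of
the momentum is orthogonal to `m`. -/
theorem IsClosedTrajectory.inner_center_eq_zero (hK : IsSymmetricBody K)
    (hγ : IsClosedTrajectory r K (polarBody K) γ) {m : EuclideanSpace ℝ (Fin n)}
    (hm : ∀ t, gauge K ((γ t).1 - m) ≤ 1) {t β : ℝ} {w : EuclideanSpace ℝ (Fin n)} (hβ0 : β ≠ 0)
    (hd : HasDerivWithinAt (fun s => (γ s).2) (β • w) (Ici t) t) : inner ℝ m w = 0 := by
  choose v w' α β' hα hβ hne hq hp hv hw using hγ.exists_right_velocity hK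
  -- The covector attains `1` at the position but is at most `1` on the position minus `m`.
  have hmw : ∀ t, β' t ≠ 0 → 0 ≤ inner ℝ (w' t) m := by
    intro t hb
    have h1 := inner_le_gauge hK.mem_nhds (hw t hb).2.1 ((γ t).1 - m)
    rw [inner_sub_left, (hw t hb).2.2, real_inner_comm] at h1
    linarith [hm t]
  have h := right_deriv_eq_zero_of_periodic (f := fun t => inner ℝ (γ t).2 m)
    (f' := fun t => β' t * inner ℝ (w' t) m)
    (hγ.continuous_snd.inner continuous_const)
    (fun t => by simp only [hγ.loop.periodic t])
    (fun t => by
      simpa [real_inner_smul_left] using (hp t).inner ℝ (hasDerivWithinAt_const t _ m))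
    (fun t => by
      by_cases hb : β' t = 0
      · simp [hb]
      · exact mul_nonneg (hβ t) (hmw t hb)) t
  have e := (uniqueDiffWithinAt_Ici t).eq_deriv _ hd (hp t)
  rw [← real_inner_smul_left, ← e, real_inner_smul_left] at h
  rw [real_inner_comm]
  exact (mul_eq_zero.mp h).resolve_left hβ0

/-- For `ℓ < 4` the curve lies in a ball about `m` of radius less than `1`, while the covector at a
bounce, being orthogonal to `m`, still takes the value `1` on `q - m`. -/
theorem IsClosedTrajectory.four_le_lengthK (hK : IsSymmetricBody K) (hr : 1 ≤ r)
    (hγ : IsClosedTrajectory r K (polarBody K) γ) : 4 ≤ lengthK K fun t => (γ t).1 := by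
  by_contra! hlt
  have hL := lengthK_nonneg K fun t => (γ t).1
  obtain ⟨t₁, ht₁⟩ := exists_arcLength_eq_add hK hr hγ.loop.fst 0
    (s := (lengthK K fun t => (γ t).1) / 2) ⟨by linarith, by linarith⟩
  have hm := gauge_sub_midpoint_le hK hr hγ.loop.fst ht₁
  obtain ⟨t, β, w, hβ, hd, -, hw, h1⟩ := hγ.exists_bounce hK
  have h0 := hγ.inner_center_eq_zero hK (fun t => (hm t).trans (by linarith)) hβ hd
  have h2 := inner_le_gauge hK.mem_nhds hw ((γ t).1 - (1 / 2 : ℝ) • ((γ 0).1 + (γ t₁).1))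
  rw [inner_sub_left, h0, h1] at h2
  linarith [hm t]

/-- A closed trajectory of length `4` has, parametrized by its arc length, the position of a
two-bounce orbit. -/
theorem IsClosedTrajectory.exists_eq_smul_of_lengthK (hK : IsSymmetricBody K)
    (hstrict : StrictConvex ℝ K) (hr : 1 ≤ r)
    (hγ : IsClosedTrajectory r K (polarBody K) γ) (hL : lengthK K (fun t => (γ t).1) = 4) :
    ∃ t₀, (γ t₀).1 ∈ frontier K ∧ ∀ t s,
      arcLength K (fun t => (γ t).1) t = arcLength K (fun t => (γ t).1) t₀ + s →
      (s ∈ Icc 0 2 → (γ t).1 = (1 - s) • (γ t₀).1) ∧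
      (s ∈ Icc 2 4 → (γ t).1 = (s - 3) • (γ t₀).1) := by
  obtain ⟨t₀, β, w, hβ, hd, hq, hw, h1⟩ := hγ.exists_bounce hK
  have hc := hγ.loop.fst
  refine ⟨t₀, hq, ?_⟩
  have hmem : ∀ t, (γ t).1 ∈ K := fun t => by
    have h := hγ.mem_frontier t
    rw [frontier_prod_eq, hK.isCompact.isClosed.closure_eq] at h
    rcases h with h | h
    · exact h.1
    · exact hK.isCompact.isClosed.frontier_subset h.1
  obtain ⟨t₁, ht₁⟩ := exists_arcLength_eq_add hK hr hc t₀ (s := 2)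
    ⟨by norm_num, by rw [hL]; norm_num⟩
  have hm := gauge_sub_midpoint_le hK hr hc (t₀ := t₀) (t₁ := t₁) (by rw [ht₁, hL]; norm_num)
  have h0 := hγ.inner_center_eq_zero hK (fun t => (hm t).trans (by rw [hL]; norm_num)) hβ hd
  -- Orthogonality of `w` to the midpoint gives `⟨q(t₁), w⟩ = -1`, so the two halving points are at
  -- distance at least `2`.
  have hanti : (γ t₁).1 = -(γ t₀).1 := by
    refine eq_neg_of_two_le_gauge_sub hK hstrict (hmem _) (hmem _) ?_
    have h2 := inner_le_gauge hK.mem_nhds hw ((γ t₀).1 - (γ t₁).1)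
    rw [inner_smul_left, inner_add_left, h1] at h0
    rw [inner_sub_left, h1] at h2
    norm_num at h0
    linarith
  have hg : gauge K (γ t₀).1 = 1 := hK.gauge_eq_one_iff.mpr hq
  have hn : gauge K (-(γ t₀).1) = 1 := by rw [gauge_neg hK.neg_mem, hg]
  intro t s hs
  have a0 := gauge_sub_le_arcLength hK hr hc t t₀
  have a1 := gauge_sub_le_arcLength hK hr hc t₁ t
  -- The second half ends at time `t₀ + 1`, where the curve is back at its starting point with arc
  -- length increased by `4`.
  have a2 := gauge_sub_le_arcLength hK hr hc t (t₀ + 1)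
  rw [arcLength_add_one hK hr hc, hL, hs, hγ.loop.periodic t₀] at a2
  rw [hs] at a0
  rw [hs, ht₁, hanti, sub_neg_eq_add] at a1
  rw [show ∀ x : ℝ, x - (x + s) = -s from fun x => by ring] at a0
  rw [show ∀ x : ℝ, x + s - (x + 2) = s - 2 from fun x => by ring] at a1
  rw [show ∀ x : ℝ, x + 4 - (x + s) = 4 - s from fun x => by ring] at a2
  constructor
  · rintro ⟨hs0, hs2⟩
    rw [abs_of_nonpos (by linarith)] at a0 a1
    exact eq_smul_of_gauge_le hK hstrict hg (by linarith) (by linarith)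
  · rintro ⟨hs2, hs4⟩
    rw [abs_of_nonneg (by linarith)] at a1 a2
    have h := eq_smul_of_gauge_le hK hstrict (z := (γ t).1) (s := s - 2) hn
      (by rw [← gauge_neg hK.neg_mem]; convert a1 using 2; module)
      (by rw [← gauge_neg hK.neg_mem]; convert a2 using 1 <;> [skip; ring]; congr 1; module)
    rw [h]
    module

/-- On a time interval on which the position is interior, the arc length has constant speed. -/
theorem IsClosedTrajectory.exists_speed (hK : IsSymmetricBody K) (hr : 1 ≤ r)
    (hγ : IsClosedTrajectory r K (polarBody K) γ) :
    ∃ d : ℝ, ∀ a b, a ≤ b → (∀ t ∈ Ioo a b, (γ t).1 ∈ interior K) →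
      arcLength K (fun t => (γ t).1) b - arcLength K (fun t => (γ t).1) a = d * (b - a) := by
  obtain ⟨d, hd0, hd⟩ := hγ.follows_field
  refine ⟨d, fun a b hab hint => ?_⟩
  have hdisj : ∀ t ∈ Ioo a b, (γ t).1 ∉ frontier K := fun t ht h =>
    disjoint_interior_frontier.notMem_of_mem_left (hint t ht) h
  rw [arcLength_sub hK hr hγ.loop.fst]
  calc ∫ x in a..b, gauge K (deriv (fun t => (γ t).1) x) = ∫ _ in a..b, d := by
        refine intervalIntegral.integral_congr_uIoo fun t ht => ?_
        rw [uIoo_of_le hab] at ht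
        obtain ⟨u, hu, hder⟩ := hd t fun h => hdisj t ht h.1
        rcases hu with ⟨-, hp, v, hv, rfl⟩ | ⟨h, -⟩
        · have h1 := hasDerivWithinAt_fst (hder.hasDerivWithinAt (s := univ))
          rw [hasDerivWithinAt_univ] at h1
          simp only [h1.deriv, Prod.smul_fst, smul_neg, gauge_neg hK.neg_mem, hK.gauge_smul,
            abs_of_pos hd0, (of_mem_subdifferential_gauge_polarBody hK hp hv).1, mul_one]
        · exact absurd h (hdisj t ht)
    _ = d * (b - a) := by rw [intervalIntegral.integral_const, smul_eq_mul, mul_comm]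

end Trajectories

/-! ### Trajectories of length four are exactly two-bounce orbits. -/

section Shortest

variable {n : ℕ} {K : Set (EuclideanSpace ℝ (Fin n))} {r : ℕ∞}
  {γ : ℝ → EuclideanSpace ℝ (Fin n) × EuclideanSpace ℝ (Fin n)}
  {c : ℝ → EuclideanSpace ℝ (Fin n)}

/-- Applied to arc length, the extreme points of a level set delimit the rest at a bounce point;
compactness comes from the growth by `l` over each period. -/
theorem exists_level_set_bounds {σ : ℝ → ℝ} {l : ℝ} (hl : 0 < l) (hσ : Continuous σ)
    (hmono : Monotone σ) (hadd : ∀ t, σ (t + 1) = σ t + l) (t₀ : ℝ) :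
    ∃ a b, a ≤ b ∧ σ a = σ t₀ ∧ σ b = σ t₀ ∧ ∀ t, σ t = σ t₀ → t ∈ Icc a b := by
  have hsub : {t | σ t = σ t₀} ⊆ Icc (t₀ - 1) (t₀ + 1) := by
    intro t (ht : σ t = σ t₀)
    refine ⟨le_of_not_gt fun h => ?_, le_of_not_gt fun h => ?_⟩
    · have h1 := hadd (t₀ - 1)
      rw [sub_add_cancel] at h1
      linarith [hmono h.le]
    · linarith [hmono h.le, hadd t₀]
  have hcpt : IsCompact {t | σ t = σ t₀} :=
    isCompact_Icc.of_isClosed_subset (isClosed_eq hσ continuous_const) hsub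
  obtain ⟨a, ha⟩ := hcpt.exists_isLeast ⟨t₀, rfl⟩
  obtain ⟨b, hb⟩ := hcpt.exists_isGreatest ⟨t₀, rfl⟩
  exact ⟨a, b, hb.2 ha.1, ha.1, hb.1, fun t ht => ⟨ha.2 ht, hb.2 ht⟩⟩

/-- The rests are the level sets of arc length at `σ τ` and `σ τ + 2`. Between them the position is
interior, so arc length is affine in time and each passage has constant speed. -/
theorem IsClosedTrajectory.exists_isTwoBounceOrbit (hK : IsSymmetricBody K)
    (hstrict : StrictConvex ℝ K) (hr : 1 ≤ r)
    (hγ : IsClosedTrajectory r K (polarBody K) γ) (hL : lengthK K (fun t => (γ t).1) = 4) :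
    ∃ q ∈ frontier K, IsTwoBounceOrbit q fun t => (γ t).1 := by
  obtain ⟨τ, hq, hsmul⟩ := hγ.exists_eq_smul_of_lengthK hK hstrict hr hL
  obtain ⟨d, hd⟩ := hγ.exists_speed hK hr
  have hc := hγ.loop.fst
  obtain ⟨τ', hτ'⟩ := exists_arcLength_eq_add hK hr hc τ (s := 2)
    ⟨by norm_num, by rw [hL]; norm_num⟩
  have hcont := continuous_arcLength hK hr hc
  have hmono := monotone_arcLength hK hr hc
  have hadd := arcLength_add_one hK hr hc
  rw [hL] at hadd
  set σ := arcLength K fun t => (γ t).1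
  set a := (γ τ).1
  have hg : gauge K a = 1 := hK.gauge_eq_one_iff.mpr hq
  have hint : ∀ x : ℝ, |x| < 1 → x • a ∈ interior K := fun x hx => by
    rwa [← hK.gauge_lt_one_iff, hK.gauge_smul, hg, mul_one]
  obtain ⟨A₀, A, hA, hA₀σ, hAσ, hAm⟩ :=
    exists_level_set_bounds (by norm_num) hcont hmono hadd τ
  obtain ⟨B, C, hB, hBσ, hCσ, hBm⟩ :=
    exists_level_set_bounds (by norm_num) hcont hmono hadd τ'
  rw [hτ'] at hBσ hCσ hBm
  have hDσ : σ (A₀ + 1) = σ τ + 4 := by rw [hadd, hA₀σ]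
  have hAB : A < B := lt_of_not_ge fun h => by linarith [hmono h]
  have hCD : C < A₀ + 1 := lt_of_not_ge fun h => by linarith [hmono h]
  have hflight₁ : ∀ t ∈ Icc A B, (γ t).1 = (1 - (σ t - σ τ)) • a := fun t ht =>
    (hsmul t (σ t - σ τ) (by ring)).1 ⟨by linarith [hmono ht.1], by linarith [hmono ht.2]⟩
  have hflight₂ : ∀ t ∈ Icc C (A₀ + 1), (γ t).1 = (σ t - σ τ - 3) • a := fun t ht =>
    (hsmul t (σ t - σ τ) (by ring)).2 ⟨by linarith [hmono ht.1], by linarith [hmono ht.2]⟩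
  have hint₁ : ∀ t ∈ Ioo A B, (γ t).1 ∈ interior K := fun t ht => by
    rw [hflight₁ t (Ioo_subset_Icc_self ht)]
    have h1 := lt_of_le_of_ne (hmono ht.1.le) fun h => ht.1.not_ge (hAm t (by rw [← h, hAσ])).2
    have h2 := lt_of_le_of_ne (hmono ht.2.le) fun h => ht.2.not_ge (hBm t (by rw [h, hBσ])).1
    exact hint _ (abs_lt.mpr ⟨by linarith, by linarith⟩)
  have hint₂ : ∀ t ∈ Ioo C (A₀ + 1), (γ t).1 ∈ interior K := fun t ht => by
    rw [hflight₂ t (Ioo_subset_Icc_self ht)]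
    have h1 := lt_of_le_of_ne (hmono ht.1.le) fun h => ht.1.not_ge (hBm t (by rw [← h, hCσ])).2
    have h2 := lt_of_le_of_ne (hmono ht.2.le) fun h => by
      -- If `t` were already on the level `σ τ + 4`, then `t - 1` would lie on the first level set,
      -- to the left of its minimum `A₀`.
      have h3 := hadd (t - 1)
      rw [sub_add_cancel] at h3
      have h4 := (hAm (t - 1) (by linarith)).1
      linarith [ht.2]
    exact hint _ (abs_lt.mpr ⟨by linarith, by linarith⟩)
  refine ⟨a, hq, hc.periodic, A₀, A, B, C, hA, hAB, hB, hCD, fun t ht => ?_, fun t ht => ?_,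
    fun t ht => ?_, fun t ht => ?_⟩
  · have h : σ t = σ τ + 0 := by linarith [hmono ht.1, hmono ht.2]
    have h1 := (hsmul t 0 h).1 ⟨le_rfl, by norm_num⟩
    rwa [sub_zero, one_smul] at h1
  · have h1 := hd A t ht.1 fun x hx => hint₁ x ⟨hx.1, hx.2.trans_le ht.2⟩
    have h2 := hd A B hAB.le hint₁
    have h3 : σ t - σ τ = 2 * ((t - A) / (B - A)) := by
      rw [← mul_div_assoc, eq_div_iff (sub_pos.mpr hAB).ne']
      rw [hAσ, hBσ] at h2
      rw [hAσ] at h1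
      -- The rate `d` is eliminated by comparing with the whole passage, which has length `2`.
      have e : 2 = d * (B - A) := by linarith
      rw [h1, e]
      ring
    beta_reduce
    rw [hflight₁ t ht, h3, AffineMap.lineMap_apply_module]
    module
  · have h : σ t = σ τ + 2 := by linarith [hmono ht.1, hmono ht.2]
    beta_reduce
    rw [(hsmul t 2 h).1 ⟨by norm_num, le_rfl⟩]
    module
  · have h1 := hd C t ht.1 fun x hx => hint₂ x ⟨hx.1, hx.2.trans_le ht.2⟩
    have h2 := hd C (A₀ + 1) hCD.le hint₂
    have h3 : σ t - σ τ = 2 + 2 * ((t - C) / (A₀ + 1 - C)) := by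
      rw [← mul_div_assoc, ← sub_eq_iff_eq_add', eq_div_iff (sub_pos.mpr hCD).ne']
      rw [hCσ, hDσ] at h2
      rw [hCσ] at h1
      have e : 2 = d * (A₀ + 1 - C) := by linarith
      have e' : σ t - σ τ - 2 = d * (t - C) := by linarith
      rw [e', e]
      ring
    beta_reduce
    rw [hflight₂ t ht, h3, AffineMap.lineMap_apply_module]
    module

theorem integral_gauge_deriv_of_eqOn_lineMap (hK : IsSymmetricBody K)
    {x y : EuclideanSpace ℝ (Fin n)} {a b : ℝ} (hab : a < b)
    (h : ∀ t ∈ Icc a b, c t = AffineMap.lineMap x y ((t - a) / (b - a))) :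
    ∫ t in a..b, gauge K (deriv c t) = gauge K (y - x) := by
  have hba : 0 < b - a := sub_pos.mpr hab
  calc ∫ t in a..b, gauge K (deriv c t) = ∫ _ in a..b, (b - a)⁻¹ * gauge K (y - x) := by
        refine intervalIntegral.integral_congr_uIoo fun t ht => ?_
        rw [uIoo_of_le hab.le] at ht
        have e : c =ᶠ[𝓝 t] fun t => AffineMap.lineMap x y ((t - a) / (b - a)) := by
          filter_upwards [Icc_mem_nhds ht.1 ht.2] with s hs using h s hs
        have h1 : HasDerivAt (fun t : ℝ => (t - a) / (b - a)) (b - a)⁻¹ t := by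
          simpa using ((hasDerivAt_id t).sub_const a).div_const (b - a)
        have h2 : HasDerivAt (fun t => AffineMap.lineMap x y ((t - a) / (b - a)))
            ((b - a)⁻¹ • (y - x)) t := by
          simp only [AffineMap.lineMap_apply_module']
          exact (h1.smul_const (y - x)).add_const x
        simp only [e.deriv_eq, h2.deriv, hK.gauge_smul, abs_of_pos (inv_pos.mpr hba)]
    _ = gauge K (y - x) := by
        rw [intervalIntegral.integral_const, smul_eq_mul, mul_inv_cancel_left₀ hba.ne']

theorem integral_gauge_deriv_of_eqOn_const (K : Set (EuclideanSpace ℝ (Fin n)))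
    {x : EuclideanSpace ℝ (Fin n)} {a b : ℝ} (hab : a ≤ b) (h : ∀ t ∈ Icc a b, c t = x) :
    ∫ t in a..b, gauge K (deriv c t) = 0 := by
  calc ∫ t in a..b, gauge K (deriv c t) = ∫ _ in a..b, (0 : ℝ) := by
        refine intervalIntegral.integral_congr_uIoo fun t ht => ?_
        rw [uIoo_of_le hab] at ht
        have e : c =ᶠ[𝓝 t] fun _ => x := by
          filter_upwards [Icc_mem_nhds ht.1 ht.2] with s hs using h s hs
        simp only [e.deriv_eq, deriv_const, gauge_zero]
    _ = 0 := intervalIntegral.integral_zero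

theorem IsTwoBounceOrbit.lengthK_eq (hK : IsSymmetricBody K) (hr : 1 ≤ r)
    (hc : IsPiecewiseSmoothLoop r c) {q : EuclideanSpace ℝ (Fin n)} (hq : q ∈ frontier K)
    (h : IsTwoBounceOrbit q c) : lengthK K c = 4 := by
  obtain ⟨-, t₀, t₁, t₂, t₃, h01, h12, h23, h34, c0, c1, c2, c3⟩ := h
  have hg : gauge K q = 1 := hK.gauge_eq_one_iff.mpr hq
  have e0 := integral_gauge_deriv_of_eqOn_const K h01 c0
  have e1 := integral_gauge_deriv_of_eqOn_lineMap hK h12 c1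
  have e2 := integral_gauge_deriv_of_eqOn_const K h23 c2
  have e3 := integral_gauge_deriv_of_eqOn_lineMap hK h34 c3
  rw [← arcLength_sub hK hr hc] at e0 e1 e2 e3
  rw [show -q - q = (-2 : ℝ) • q by module, hK.gauge_smul, hg] at e1
  rw [show q - -q = (2 : ℝ) • q by module, hK.gauge_smul, hg] at e3
  have e4 := arcLength_add_one hK hr hc t₀
  norm_num at e1 e3
  linarith

end Shortest

/-! ### The rectangle loop over a boundary point and a supporting covector. -/

section Existence

/-- The `1`-periodic zigzag function which is `1` on `[0, 1/4]`, falls to `-1` on `[1/4, 1/2]`,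
rests there on `[1/2, 3/4]` and rises to `1` on `[3/4, 1]`. -/
noncomputable def zigzag (t : ℝ) : ℝ :=
  -- The centre `1/8` is the midpoint of the rest at `1`; the tent reaches `1` at distance `1/8`
  -- from it and `-1` at distance `3/8`.
  max (-1) (min 1 (2 - 8 * ‖((t - 1 / 8 : ℝ) : UnitAddCircle)‖))

theorem continuous_zigzag : Continuous zigzag := by
  have h : Continuous fun t : ℝ => ((t - 1 / 8 : ℝ) : UnitAddCircle) :=
    (AddCircle.continuous_mk' 1).comp (by fun_prop)
  unfold zigzag
  fun_prop

theorem periodic_zigzag : Function.Periodic zigzag 1 := fun t => by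
  have h : ((t + 1 - 1 / 8 : ℝ) : UnitAddCircle) = ((t - 1 / 8 : ℝ) : UnitAddCircle) := by
    rw [show t + 1 - 1 / 8 = t - 1 / 8 + 1 by ring, AddCircle.coe_add_period]
  simp only [zigzag, h]

theorem zigzag_eq {t : ℝ} (k : ℤ) (h : |t - k - 1 / 8| ≤ 1 / 2) :
    zigzag t = max (-1) (min 1 (2 - 8 * |t - k - 1 / 8|)) := by
  have e : zigzag t = zigzag (t - k) := by
    simpa using (periodic_zigzag.sub_int_mul_eq k (x := t)).symm
  have e' : ‖((t - k - 1 / 8 : ℝ) : UnitAddCircle)‖ = |t - k - 1 / 8| :=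
    (AddCircle.norm_coe_eq_abs_iff 1 one_ne_zero).mpr (by simpa using h)
  rw [e, zigzag, e']

theorem zigzag_eq_one {t : ℝ} (k : ℤ) (h : t ∈ Icc (k : ℝ) (k + 1 / 4)) : zigzag t = 1 := by
  have h1 : |t - k - 1 / 8| ≤ 1 / 8 := abs_le.mpr ⟨by linarith [h.1], by linarith [h.2]⟩
  rw [zigzag_eq k (h1.trans (by norm_num)), min_eq_left (by linarith), max_eq_right (by norm_num)]

theorem zigzag_eq_falling {t : ℝ} (k : ℤ) (h : t ∈ Icc (k + 1 / 4 : ℝ) (k + 1 / 2)) :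
    zigzag t = 3 - 8 * (t - k) := by
  have h1 : |t - k - 1 / 8| = t - k - 1 / 8 := abs_of_nonneg (by linarith [h.1])
  rw [zigzag_eq k (by rw [h1]; linarith [h.2]), h1, min_eq_right (by linarith [h.1]),
    max_eq_right (by linarith [h.2])]
  ring

theorem zigzag_eq_neg_one {t : ℝ} (k : ℤ) (h : t ∈ Icc (k + 1 / 2 : ℝ) (k + 3 / 4)) :
    zigzag t = -1 := by
  rcases le_total t (k + 5 / 8) with h' | h'
  · have h1 : |t - k - 1 / 8| = t - k - 1 / 8 := abs_of_nonneg (by linarith [h.1])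
    rw [zigzag_eq k (by rw [h1]; linarith), h1, max_eq_left]
    exact (min_le_right _ _).trans (by linarith [h.1])
  -- Past `k + 5/8` the nearest centre is that of the next period.
  · have h1 : |t - (k + 1 : ℤ) - 1 / 8| = -(t - (k + 1 : ℤ) - 1 / 8) :=
      abs_of_nonpos (by push_cast; linarith [h.2])
    rw [zigzag_eq (k + 1) (by rw [h1]; push_cast; linarith), h1, max_eq_left]
    refine (min_le_right _ _).trans ?_
    push_cast
    linarith [h.2]

theorem zigzag_eq_rising {t : ℝ} (k : ℤ) (h : t ∈ Icc (k + 3 / 4 : ℝ) (k + 1)) :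
    zigzag t = 8 * (t - k) - 7 := by
  have h1 : |t - (k + 1 : ℤ) - 1 / 8| = -(t - (k + 1 : ℤ) - 1 / 8) :=
    abs_of_nonpos (by push_cast; linarith [h.2])
  rw [zigzag_eq (k + 1) (by rw [h1]; push_cast; linarith [h.1]), h1]
  push_cast
  rw [min_eq_right (by linarith [h.2]), max_eq_right (by linarith [h.1])]
  ring

/-- On each quarter of the period one of `zigzag t` and `zigzag (t - 1/4)` rests at `±1`, while the
other one runs with slope `±8` between `-1` and `1`. -/
theorem zigzag_quarter (j : ℤ) : ∃ ε : ℝ, (ε = 1 ∨ ε = -1) ∧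
    ((∀ t ∈ Icc (j / 4 : ℝ) ((j + 1) / 4),
        zigzag t = ε ∧ zigzag (t - 1 / 4) = (8 * (t - j / 4) - 1) * ε) ∨
     (∀ t ∈ Icc (j / 4 : ℝ) ((j + 1) / 4),
        zigzag t = (8 * (t - j / 4) - 1) * -ε ∧ zigzag (t - 1 / 4) = ε)) := by
  obtain ⟨k, rfl | rfl | rfl | rfl⟩ :
      ∃ k : ℤ, j = 4 * k ∨ j = 4 * k + 1 ∨ j = 4 * k + 2 ∨ j = 4 * k + 3 :=
    ⟨j / 4, by omega⟩
  · refine ⟨1, Or.inl rfl, Or.inl fun t ht => ?_⟩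
    push_cast at ht ⊢
    rw [zigzag_eq_one k ⟨by linarith [ht.1], by linarith [ht.2]⟩, zigzag_eq_rising (k - 1)
      ⟨by push_cast; linarith [ht.1], by push_cast; linarith [ht.2]⟩]
    push_cast
    exact ⟨rfl, by ring⟩
  · refine ⟨1, Or.inl rfl, Or.inr fun t ht => ?_⟩
    push_cast at ht ⊢
    rw [zigzag_eq_falling k ⟨by linarith [ht.1], by linarith [ht.2]⟩, zigzag_eq_one k
      ⟨by linarith [ht.1], by linarith [ht.2]⟩]
    exact ⟨by ring, rfl⟩
  · refine ⟨-1, Or.inr rfl, Or.inl fun t ht => ?_⟩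
    push_cast at ht ⊢
    rw [zigzag_eq_neg_one k ⟨by linarith [ht.1], by linarith [ht.2]⟩, zigzag_eq_falling k
      ⟨by linarith [ht.1], by linarith [ht.2]⟩]
    exact ⟨rfl, by ring⟩
  · refine ⟨-1, Or.inr rfl, Or.inr fun t ht => ?_⟩
    push_cast at ht ⊢
    rw [zigzag_eq_rising k ⟨by linarith [ht.1], by linarith [ht.2]⟩, zigzag_eq_neg_one k
      ⟨by linarith [ht.1], by linarith [ht.2]⟩]
    exact ⟨by ring, rfl⟩

variable {n : ℕ} {K : Set (EuclideanSpace ℝ (Fin n))}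

/-- The closed trajectory around the rectangle with corners `(±q, ±p)`. -/
noncomputable def rectangleLoop (q p : EuclideanSpace ℝ (Fin n)) (t : ℝ) :
    EuclideanSpace ℝ (Fin n) × EuclideanSpace ℝ (Fin n) :=
  (zigzag t • q, zigzag (t - 1 / 4) • p)

/-- A boundary point of `K` and a supporting covector of `K` at it. -/
def IsDualPair (K : Set (EuclideanSpace ℝ (Fin n))) (q p : EuclideanSpace ℝ (Fin n)) : Prop :=
  q ∈ frontier K ∧ p ∈ polarBody K ∧ inner ℝ q p = (1 : ℝ)

theorem IsDualPair.smul {q p : EuclideanSpace ℝ (Fin n)} (hK : IsSymmetricBody K)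
    (h : IsDualPair K q p) {ε : ℝ} (hε : ε = 1 ∨ ε = -1) : IsDualPair K (ε • q) (ε • p) := by
  rcases hε with rfl | rfl
  · simpa using h
  · obtain ⟨h1, h2, h3⟩ := h
    refine ⟨?_, by simpa using hK.polarBody.neg_mem p h2, by simpa using h3⟩
    rw [← hK.gauge_eq_one_iff] at h1 ⊢
    rw [hK.gauge_smul, h1]
    simp

theorem IsDualPair.mem_frontier_polarBody {q p : EuclideanSpace ℝ (Fin n)}
    (hK : IsSymmetricBody K) (h : IsDualPair K q p) : p ∈ frontier (polarBody K) := by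
  rw [← hK.polarBody.gauge_eq_one_iff]
  refine le_antisymm (gauge_le_one_of_mem h.2.1) ?_
  rw [← h.2.2, real_inner_comm]
  refine inner_le_gauge hK.polarBody.mem_nhds (fun p' hp' => ?_) p
  rw [real_inner_comm]
  exact hp' q (hK.isCompact.isClosed.frontier_subset h.1)

theorem IsDualPair.mem_subdifferential {q p : EuclideanSpace ℝ (Fin n)}
    (hK : IsSymmetricBody K) (h : IsDualPair K q p) : p ∈ subdifferential (gauge K) q := by
  refine mem_subdifferential_gauge (hK.gauge_eq_one_iff.mpr h.1)
    (by rw [real_inner_comm, h.2.2]) fun y => ?_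
  rw [real_inner_comm]
  exact inner_le_gauge hK.mem_nhds h.2.1 y

/-- Being a dual pair is symmetric between `K` and `T`: the same equality `⟨q, p⟩ = 1` makes each
vector a subgradient at the other. -/
theorem IsDualPair.mem_subdifferential_polarBody {q p : EuclideanSpace ℝ (Fin n)}
    (hK : IsSymmetricBody K) (h : IsDualPair K q p) :
    q ∈ subdifferential (gauge (polarBody K)) p := by
  refine mem_subdifferential_gauge
    (hK.polarBody.gauge_eq_one_iff.mpr (h.mem_frontier_polarBody hK)) h.2.2 fun y => ?_
  rw [real_inner_comm]
  refine inner_le_gauge hK.polarBody.mem_nhds (fun p' hp' => ?_) y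
  rw [real_inner_comm]
  exact hp' q (hK.isCompact.isClosed.frontier_subset h.1)

theorem IsSymmetricBody.smul_mem_of_frontier (hK : IsSymmetricBody K)
    {x : EuclideanSpace ℝ (Fin n)} (hx : x ∈ frontier K) {θ : ℝ} (hθ : |θ| ≤ 1) :
    θ • x ∈ K ∧ (θ • x ∈ interior K ∨ θ = 1 ∨ θ = -1) := by
  have e : gauge K (θ • x) = |θ| := by
    rw [hK.gauge_smul, hK.gauge_eq_one_iff.mpr hx, mul_one]
  refine ⟨hK.gauge_le_one_iff.mp (e ▸ hθ), ?_⟩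
  rcases hθ.eq_or_lt with h | h
  · exact Or.inr (eq_or_eq_neg_of_abs_eq h)
  · exact Or.inl (hK.gauge_lt_one_iff.mp (e ▸ h))

/-- On each quarter of the period the rectangle loop runs with constant admissible velocity. -/
theorem rectangleLoop_quarter {q p : EuclideanSpace ℝ (Fin n)} (hK : IsSymmetricBody K)
    (h : IsDualPair K q p) (j : ℤ) :
    ∃ P U : EuclideanSpace ℝ (Fin n) × EuclideanSpace ℝ (Fin n),
      rectangleLoop q p (j / 4) ∈ frontier K ×ˢ frontier (polarBody K) ∧
      ∀ t ∈ Icc (j / 4 : ℝ) ((j + 1) / 4), rectangleLoop q p t = P + t • U ∧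
        rectangleLoop q p t ∈ frontier (K ×ˢ polarBody K) ∧
        (rectangleLoop q p t ∈ frontier K ×ˢ frontier (polarBody K) →
          U ∈ cornerCone K (polarBody K) (rectangleLoop q p t)) ∧
        (rectangleLoop q p t ∉ frontier K ×ˢ frontier (polarBody K) →
          ∃ u ∈ fieldValues K (polarBody K) (rectangleLoop q p t), U = (8 : ℝ) • u) := by
  have hprod : ∀ x y : EuclideanSpace ℝ (Fin n), (x ∈ frontier K ∧ y ∈ polarBody K) ∨
      (x ∈ K ∧ y ∈ frontier (polarBody K)) → (x, y) ∈ frontier (K ×ˢ polarBody K) := by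
    intro x y hxy
    rw [frontier_prod_eq, hK.isCompact.isClosed.closure_eq,
      hK.polarBody.isCompact.isClosed.closure_eq]
    exact hxy.symm
  have hleft : (j / 4 : ℝ) ∈ Icc (j / 4 : ℝ) ((j + 1) / 4) := ⟨le_rfl, by linarith⟩
  have hθ : ∀ t ∈ Icc (j / 4 : ℝ) ((j + 1) / 4), |8 * (t - j / 4) - 1| ≤ 1 := fun t ht =>
    abs_le.mpr ⟨by linarith [ht.1], by linarith [ht.2]⟩
  obtain ⟨ε, hε, hz | hz⟩ := zigzag_quarter j
  -- The position rests at `ε q` while the momentum runs from `-ε p` to `ε p`.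
  · have hd := h.smul hK hε
    have hT := hd.mem_frontier_polarBody hK
    have e : ∀ t ∈ Icc (j / 4 : ℝ) ((j + 1) / 4),
        rectangleLoop q p t = (ε • q, (8 * (t - j / 4) - 1) • ε • p) := fun t ht => by
      rw [rectangleLoop, (hz t ht).1, (hz t ht).2, smul_smul]
    refine ⟨(ε • q, (-2 * j - 1 : ℝ) • ε • p), (0, (8 : ℝ) • ε • p), ?_, fun t ht => ?_⟩
    · rw [e _ hleft]
      refine ⟨hd.1, ?_⟩
      have := (hd.smul hK (Or.inr rfl)).mem_frontier_polarBody hK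
      simpa using this
    · obtain ⟨hmem, hcase⟩ := hK.polarBody.smul_mem_of_frontier hT (hθ t ht)
      rw [e t ht]
      set θ := 8 * (t - j / 4) - 1 with hθdef
      refine ⟨?_, hprod _ _ (Or.inl ⟨hd.1, hmem⟩), fun hc => ?_, fun hc => ?_⟩
      · refine Prod.ext (by simp) ?_
        simp only [hθdef, Prod.snd_add, Prod.smul_snd]
        module
      · have h1 : θ = 1 ∨ θ = -1 := hcase.resolve_left fun hi =>
          disjoint_interior_frontier.notMem_of_mem_left hi hc.2
        -- Here `θ = ±1`. The position does not move, so `α = 0`, but the corner cone still asks for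
        -- a subgradient of `g_T` at the momentum.
        refine ⟨θ • ε • q, (hd.smul hK h1).mem_subdifferential_polarBody hK, ε • p,
          hd.mem_subdifferential hK, 0, 8, le_rfl, by norm_num, by simp, by simp⟩
      · have h1 : θ • ε • p ∈ interior (polarBody K) := hcase.resolve_right fun h1 =>
          hc ⟨hd.1, (hd.smul hK h1).mem_frontier_polarBody hK⟩
        exact ⟨(0, ε • p), Or.inr ⟨hd.1, h1, ε • p, hd.mem_subdifferential hK, rfl⟩, by simp⟩
  -- The momentum rests at `ε p` while the position runs from `ε q` to `-ε q`, against the momentum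
  -- as the sign in the field requires.
  · have hd := h.smul hK hε
    have hd' := hd.smul hK (Or.inr rfl)
    rw [neg_one_smul, neg_one_smul] at hd'
    have hT := hd.mem_frontier_polarBody hK
    have e : ∀ t ∈ Icc (j / 4 : ℝ) ((j + 1) / 4),
        rectangleLoop q p t = ((8 * (t - j / 4) - 1) • -(ε • q), ε • p) := fun t ht => by
      rw [rectangleLoop, (hz t ht).1, (hz t ht).2, ← neg_smul, smul_smul]
    refine ⟨((-2 * j - 1 : ℝ) • -(ε • q), ε • p), ((8 : ℝ) • -(ε • q), 0), ?_, fun t ht => ?_⟩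
    · rw [e _ hleft]
      refine ⟨?_, hT⟩
      simpa using hd.1
    · obtain ⟨hmem, hcase⟩ := hK.smul_mem_of_frontier hd'.1 (hθ t ht)
      rw [e t ht]
      set θ := 8 * (t - j / 4) - 1 with hθdef
      refine ⟨?_, hprod _ _ (Or.inr ⟨hmem, hT⟩), fun hc => ?_, fun hc => ?_⟩
      · refine Prod.ext ?_ (by simp)
        simp only [hθdef, Prod.fst_add, Prod.smul_fst]
        module
      · have h1 : θ = 1 ∨ θ = -1 := hcase.resolve_left fun hi =>
          disjoint_interior_frontier.notMem_of_mem_left hi hc.1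
        refine ⟨ε • q, hd.mem_subdifferential_polarBody hK, θ • -(ε • p),
          (hd'.smul hK h1).mem_subdifferential hK, 8, 0, by norm_num, le_rfl, by simp, by simp⟩
      · have h1 : θ • -(ε • q) ∈ interior K := hcase.resolve_right fun h1 =>
          hc ⟨(hd'.smul hK h1).1, hT⟩
        exact ⟨(-(ε • q), 0), Or.inl ⟨h1, hT, ε • q, hd.mem_subdifferential_polarBody hK, rfl⟩,
          by simp⟩

theorem isClosedTrajectory_rectangleLoop {q p : EuclideanSpace ℝ (Fin n)}
    (hK : IsSymmetricBody K) (h : IsDualPair K q p) (r : ℕ∞) :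
    IsClosedTrajectory r K (polarBody K) (rectangleLoop q p) := by
  choose P U hcorner hquarter using rectangleLoop_quarter hK h
  -- The floor selects the quarter to the right of `t` and the ceiling minus one the quarter to the
  -- left, giving the two one-sided derivatives at corners.
  have hright : ∀ t : ℝ, t ∈ Ico ((⌊4 * t⌋ : ℝ) / 4) ((⌊4 * t⌋ + 1) / 4) := fun t =>
    ⟨by linarith [Int.floor_le (4 * t)], by linarith [Int.lt_floor_add_one (4 * t)]⟩
  have hleft : ∀ t : ℝ, t ∈ Ioc (((⌈4 * t⌉ - 1 : ℤ) : ℝ) / 4) (((⌈4 * t⌉ - 1 : ℤ) + 1) / 4) :=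
    fun t => by
      push_cast
      exact ⟨by linarith [Int.ceil_lt_add_one (4 * t)], by linarith [Int.le_ceil (4 * t)]⟩
  have haff : ∀ j t, HasDerivAt (fun s : ℝ => P j + s • U j) (U j) t := fun j t => by
    simpa using ((hasDerivAt_id t).smul_const (U j)).const_add (P j)
  have heq : ∀ j, EqOn (rectangleLoop q p) (fun s : ℝ => P j + s • U j)
      (Icc (j / 4 : ℝ) ((j + 1) / 4)) := fun j t ht => (hquarter j t ht).1
  refine ⟨⟨?_, fun t => ?_, 4, fun i => i / 4, fun a b hab => ?_, by simp, by norm_num,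
    fun i _ => ?_⟩, fun t => ?_, ⟨8, by norm_num, fun t ht => ?_⟩, fun t ht => ⟨?_, ?_⟩⟩
  · exact (continuous_zigzag.smul continuous_const).prodMk
      ((continuous_zigzag.comp (by fun_prop)).smul continuous_const)
  · simp only [rectangleLoop, periodic_zigzag t]
    rw [show t + 1 - 1 / 4 = t - 1 / 4 + 1 by ring, periodic_zigzag]
  · have : (a : ℝ) < b := by exact_mod_cast hab
    simp only
    linarith
  · have h1 := heq i
    simp only [Int.cast_natCast] at h1
    simp only [Nat.cast_add, Nat.cast_one]
    refine ContDiffOn.congr (f := fun s : ℝ => P i + s • U i) ?_ h1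
    exact ContDiff.contDiffOn (by fun_prop)
  · exact (hquarter _ t (Ico_subset_Icc_self (hright t))).2.1
  · obtain ⟨-, -, -, h4⟩ := hquarter _ t (Ico_subset_Icc_self (hright t))
    obtain ⟨u, hu, e⟩ := h4 ht
    refine ⟨u, hu, ?_⟩
    rw [← e]
    -- Quarter points are corners, so off the corners `t` is interior to its quarter and the
    -- derivative is two-sided.
    have hne : (⌊4 * t⌋ : ℝ) / 4 ≠ t := fun h0 => ht (by
      have := hcorner ⌊4 * t⌋
      rwa [h0] at this)
    exact (haff _ t).congr_of_eventuallyEq ((heq _).eventuallyEq_of_mem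
      (Icc_mem_nhds (lt_of_le_of_ne (hright t).1 hne) (hright t).2))
  · have hmem := Ioc_subset_Icc_self (hleft t)
    refine ⟨_, (hquarter _ t hmem).2.2.1 ht, (haff _ t).hasDerivWithinAt.congr_of_eventuallyEq
      ((heq _).eventuallyEq_of_mem ?_) (heq _ hmem)⟩
    exact mem_of_superset (Icc_mem_nhdsLE (hleft t).1) (Icc_subset_Icc_right (hleft t).2)
  · have hmem := Ico_subset_Icc_self (hright t)
    refine ⟨_, (hquarter _ t hmem).2.2.1 ht, (haff _ t).hasDerivWithinAt.congr_of_eventuallyEq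
      ((heq _).eventuallyEq_of_mem ?_) (heq _ hmem)⟩
    exact mem_of_superset (Icc_mem_nhdsGE (hright t).2) (Icc_subset_Icc_left (hright t).1)

theorem isTwoBounceOrbit_rectangleLoop (q p : EuclideanSpace ℝ (Fin n)) :
    IsTwoBounceOrbit q fun t => (rectangleLoop q p t).1 := by
  have z0 := fun t => zigzag_eq_one (t := t) 0
  have z1 := fun t => zigzag_eq_falling (t := t) 0
  have z2 := fun t => zigzag_eq_neg_one (t := t) 0
  have z3 := fun t => zigzag_eq_rising (t := t) 0
  simp only [Int.cast_zero, zero_add, sub_zero] at z0 z1 z2 z3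
  refine ⟨fun t => by simp only [rectangleLoop, periodic_zigzag t], 0, 1 / 4, 1 / 2, 3 / 4,
    by norm_num, by norm_num, by norm_num, by norm_num, fun t ht => ?_, fun t ht => ?_,
    fun t ht => ?_, fun t ht => ?_⟩
  · simp only [rectangleLoop, z0 t ht, one_smul]
  · simp only [rectangleLoop, z1 t ht, AffineMap.lineMap_apply_module]
    module
  · simp only [rectangleLoop, z2 t ht, neg_one_smul]
  · rw [zero_add] at ht ⊢
    simp only [rectangleLoop, z3 t ht, AffineMap.lineMap_apply_module]
    module

theorem exists_isPeriodicBilliardTrajectory_isTwoBounceOrbit (hK : IsSymmetricBody K) (r : ℕ∞)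
    {q : EuclideanSpace ℝ (Fin n)} (hq : q ∈ frontier K) :
    ∃ c, IsPeriodicBilliardTrajectory r K (polarBody K) c ∧ IsTwoBounceOrbit q c := by
  obtain ⟨p, hp, hqp⟩ := exists_polar_inner_eq_one hK (hK.gauge_eq_one_iff.mpr hq)
  exact ⟨_, ⟨_, isClosedTrajectory_rectangleLoop hK ⟨hq, hp, hqp⟩ r, fun _ => rfl⟩,
    isTwoBounceOrbit_rectangleLoop q p⟩

theorem IsSymmetricBody.frontier_nonempty (hK : IsSymmetricBody K) (hn : 1 ≤ n) :
    (frontier K).Nonempty := by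
  have : NeZero n := ⟨by omega⟩
  obtain ⟨x, hx⟩ := exists_ne (0 : EuclideanSpace ℝ (Fin n))
  have hpos := hK.gauge_pos.mpr hx
  exact ⟨(gauge K x)⁻¹ • x, hK.gauge_eq_one_iff.mp (by
    rw [hK.gauge_smul, abs_of_pos (inv_pos.mpr hpos), inv_mul_cancel₀ hpos.ne'])⟩

end Existence

end MinkowskiBilliard

/-! ### The main theorem. -/

open MinkowskiBilliard in
theorem theorem1p8 (n : ℕ) (hn : 1 ≤ n) (K : Set (EuclideanSpace ℝ (Fin n)))
    (hcompact : IsCompact K) (hinterior : (interior K).Nonempty)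
    (hsymm : ∀ x ∈ K, -x ∈ K) (hstrict : StrictConvex ℝ K)
    (r : ℕ∞) (hr : 1 ≤ r) :
    (∀ c, IsPeriodicBilliardTrajectory r K (polarBody K) c →
      ((∀ c', IsPeriodicBilliardTrajectory r K (polarBody K) c' → lengthK K c ≤ lengthK K c') ↔
        ∃ q ∈ frontier K, IsTwoBounceOrbit q c)) ∧
    (∀ q ∈ frontier K, ∃ c, IsPeriodicBilliardTrajectory r K (polarBody K) c ∧
      IsTwoBounceOrbit q c) ∧
    IsLeast {l : ℝ | ∃ c, IsPeriodicBilliardTrajectory r K (polarBody K) c ∧ l = lengthK K c}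
      4 := by
  have hK := isSymmetricBody_of_strictConvex hcompact hinterior hsymm hstrict
  have hge : ∀ c, IsPeriodicBilliardTrajectory r K (polarBody K) c → 4 ≤ lengthK K c := by
    rintro c ⟨γ, hγ, hc⟩
    obtain rfl : c = fun t => (γ t).1 := funext hc
    exact hγ.four_le_lengthK hK hr
  have htwo : ∀ c, IsPeriodicBilliardTrajectory r K (polarBody K) c → ∀ q ∈ frontier K,
      IsTwoBounceOrbit q c → lengthK K c = 4 := by
    rintro c ⟨γ, hγ, hc⟩ q hq h
    obtain rfl : c = fun t => (γ t).1 := funext hc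
    exact h.lengthK_eq hK hr hγ.loop.fst hq
  -- A single two-bounce trajectory shows that the lower bound `4` is attained, so minimality
  -- amounts to having length `4`.
  obtain ⟨q₀, hq₀⟩ := hK.frontier_nonempty hn
  obtain ⟨c₀, hc₀, h₀⟩ := exists_isPeriodicBilliardTrajectory_isTwoBounceOrbit hK r hq₀
  have hL₀ := htwo c₀ hc₀ q₀ hq₀ h₀
  refine ⟨fun c hc => ⟨fun hmin => ?_, ?_⟩, fun q hq =>
    exists_isPeriodicBilliardTrajectory_isTwoBounceOrbit hK r hq, ⟨c₀, hc₀, hL₀.symm⟩, ?_⟩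
  · have hL : lengthK K c = 4 := le_antisymm (hL₀ ▸ hmin c₀ hc₀) (hge c hc)
    obtain ⟨γ, hγ, h⟩ := hc
    obtain rfl : c = fun t => (γ t).1 := funext h
    exact hγ.exists_isTwoBounceOrbit hK hstrict hr hL
  · rintro ⟨q, hq, h⟩ c' hc'
    exact (htwo c hc q hq h).trans_le (hge c' hc')
  · rintro l ⟨c, hc, rfl⟩
    exact hge c hc
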